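/- Let $\Phi$ be the (irreducible, reduced, crystallographic) root system of a connected simple complex algebraic group, with simple roots $\Pi$, positive roots $\Phi^+$, highest root $\theta$, Weyl group $W$ and coroot lattice $Q^\vee$. Let $W_a = W\ltimes Q^\vee$ be the affine Weyl group acting on $V=Q^\vee\otimes\mathbf R$. Let $S=\{s_0,s_1,\dots,s_n\}$ be its set of simple reflections: $s_1,\dots,s_n$ are the reflections in the hyperplanes $\langle\alpha,v\rangle=0$ for $\alpha\in\Pi$, and $s_0$ is the reflection in the hyperplane $\langle\theta,v\rangle=1$. Let $l$ be the length function and $<$ the Bruhat order of $W_a$ with respect to $S$. An affine root $\alpha+m\delta$ ($\alpha\in\Phi$, $m\in\mathbf Z$) is called positive if either $\alpha\in\Phi^+$ and $m>0$, or $-\alpha\in\Phi^+$ and $m\ge 0$, and negative otherwise. An element $w=w_f\tau_\lambda\in W_a$ ($w_f \in W$, $\tau_\lambda$ the translation by $\lambda\in Q^\vee$) acts on affine roots by $w(\alpha+m\delta)=w_f(\alpha)+(m+\langle\alpha,\lambda\rangle)\delta$. Let $N(w)$ be the set of positive affine roots $\tilde\alpha$ with $w^{-1}(\tilde\alpha)$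 negative, and let $\operatorname{supp}(w)=\{\alpha\in\Phi : \alpha+m\delta\in N(w)\text{ for some } m\}$. An ideal is a subset $\mathcal I\subseteq\Phi^+$ such that $\alpha\in\mathcal I$, $\beta\in\Phi^+$ and $\alpha+\beta\in\Phi^+$ imply $\alpha+\beta\in\mathcal I$; it is strictly positive if $\mathcal I\cap\Pi=\emptyset$. For an ideal $\mathcal I$ let $ST(\mathcal I)=\{w\in W_a : \operatorname{supp}(w)=\mathcal I\}$. Let $\mathcal I$ be an ideal and let $w\in ST(\mathcal I)$. Then the following are equivalent: (a) $\mathcal I$ is strictly positive and $w$ is the unique element of maximal length in $ST(\mathcal I)$; (b) for every $s\in S$ with $ws>w$ one has $ws\notin ST(\mathcal I)$. -/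

import Mathlib

/-! Word length and Bruhat order with respect to a generating set of a group. -/

/-- The word length of `g` with respect to `S`: the least length of a word in elements of `S` whose
product is `g`. -/
noncomputable def wordLength {G : Type*} [Group G] (S : Set G) (g : G) : ℕ :=
  sInf {n : ℕ | ∃ l : List G, l.length = n ∧ (∀ s ∈ l, s ∈ S) ∧ l.prod = g}

/-- The reflections of `G` relative to `S`: the conjugates of the elements of `S`. -/
def reflectionsOf {G : Type*} [Group G] (S : Set G) : Set G :=
  {t | ∃ g : G, ∃ s ∈ S, t = g * s * g⁻¹}

/-- The strict Bruhat order: `u < v` if there is a chain from `u` to `v` in which each term is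
obtained from the previous one by multiplying with a reflection, so that the length increases. -/
def BruhatLT {G : Type*} [Group G] (S : Set G) : G → G → Prop :=
  Relation.TransGen fun u v =>
    ∃ t ∈ reflectionsOf S, v = u * t ∧ wordLength S u < wordLength S v

namespace RootPairing

variable {ι M N : Type*} [AddCommGroup M] [Module ℝ M] [AddCommGroup N] [Module ℝ N]

section AffineWeyl

variable (P : RootPairing ι ℝ M N)

/-- The Weyl group `W`, acting on the space `V = N` spanned by the coroots. -/
def weylGroupOnCoweights : Subgroup (N ≃ₗ[ℝ] N) :=
  Subgroup.closure (Set.range P.coreflection)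

lemma weylGroupOnCoweights_map_corootSpan {w : N ≃ₗ[ℝ] N} (hw : w ∈ P.weylGroupOnCoweights) :
    ∀ x ∈ P.corootSpan ℤ, w x ∈ P.corootSpan ℤ := by
  have key : ∀ i, ∀ x ∈ P.corootSpan ℤ, P.coreflection i x ∈ P.corootSpan ℤ := by
    intro i x hx
    induction hx using Submodule.span_induction with
    | mem x hx =>
      obtain ⟨j, rfl⟩ := hx
      rw [← P.coroot_reflectionPerm]
      exact Submodule.subset_span ⟨_, rfl⟩
    | zero => simp
    | add x y _ _ hx hy => rw [map_add]; exact add_mem hx hy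
    | smul a x _ hx => rw [map_zsmul]; exact Submodule.smul_mem _ _ hx
  induction hw using Subgroup.closure_induction'' with
  | one => intro x hx; exact hx
  | mem g hg => obtain ⟨i, rfl⟩ := hg; exact key i
  | inv_mem g hg => obtain ⟨i, rfl⟩ := hg; rw [P.coreflection_inv]; exact key i
  | mul g h _ _ hg hh => intro x hx; exact hg _ (hh x hx)

/-- The affine Weyl group `W_a = W ⋉ Q^∨` in its (faithful) action on `V = N`: the affine
automorphisms of `V` whose linear part is in `W` and whose translation part is in the coroot
lattice `Q^∨`. -/
def affineWeylGroup : Subgroup (N ≃ᵃ[ℝ] N) where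
  carrier := {g | g.linear ∈ P.weylGroupOnCoweights ∧ g 0 ∈ P.corootSpan ℤ}
  one_mem' := ⟨one_mem P.weylGroupOnCoweights, zero_mem (P.corootSpan ℤ)⟩
  mul_mem' := by
    rintro g h ⟨hg, hg0⟩ ⟨hh, hh0⟩
    refine ⟨mul_mem hg hh, ?_⟩
    have h1 : (g * h) 0 = g.linear (h 0) + g 0 := by
      have := g.map_vadd 0 (h 0)
      simpa using this
    rw [h1]
    exact add_mem (P.weylGroupOnCoweights_map_corootSpan hg _ hh0) hg0
  inv_mem' := by
    rintro g ⟨hg, hg0⟩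
    have hg' : g⁻¹.linear ∈ P.weylGroupOnCoweights := inv_mem hg
    refine ⟨hg', ?_⟩
    have h1 : g⁻¹ 0 = -(g⁻¹.linear (g 0)) := by
      have h2 := g⁻¹.map_vadd 0 (g 0)
      have h3 : g⁻¹ (g 0) = 0 := g.symm_apply_apply 0
      simp only [vadd_eq_add, add_zero, h3] at h2
      exact eq_neg_of_add_eq_zero_right h2.symm
    rw [h1]
    exact neg_mem (P.weylGroupOnCoweights_map_corootSpan hg' _ hg0)

/-- The reflection `v ↦ v - (⟨α_i, v⟩ - m) α_i^∨` of `V` in the hyperplane `⟨α_i, v⟩ = m`, as an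
element of the affine Weyl group. -/
noncomputable def affineReflection (i : ι) (m : ℤ) : P.affineWeylGroup :=
  ⟨(P.coreflection i).toAffineEquiv.trans (AffineEquiv.constVAdd ℝ N (m • P.coroot i)), by
    constructor
    · exact Subgroup.subset_closure ⟨i, rfl⟩
    · simpa using (P.corootSpan ℤ).smul_mem m (Submodule.subset_span ⟨i, rfl⟩)⟩

lemma affineReflection_apply (i : ι) (m : ℤ) (v : N) :
    (P.affineReflection i m : N ≃ᵃ[ℝ] N) v = v - (P.root' i v - m) • P.coroot i := by
  simp only [affineReflection, AffineEquiv.trans_apply, LinearEquiv.coe_toAffineEquiv,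
    coreflection_apply, AffineEquiv.constVAdd_apply, vadd_eq_add, sub_smul,
    Int.cast_smul_eq_zsmul]
  abel

/-- The affine functional `v ↦ m - ⟨α_i, v⟩` representing the affine root `a = (i, m)`, which is
written `α_i + m δ`. -/
noncomputable def affineRootFun (a : ι × ℤ) (v : N) : ℝ := a.2 - P.root' a.1 v

/-- `w(a) = c` for `w` in the affine Weyl group and affine roots `a`, `c`: affine roots are
transported by `w` as functionals on `V`. -/
def MapsAffineRoot (w : P.affineWeylGroup) (a c : ι × ℤ) : Prop :=
  ∀ v : N, P.affineRootFun c ((w : N ≃ᵃ[ℝ] N) v) = P.affineRootFun a v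

/-- If `w = w_f τ_lam`, then `w(α + m δ) = w_f(α) + (m + ⟨α, lam⟩) δ`. -/
lemma mapsAffineRoot_iff (w : P.affineWeylGroup) (wf : N ≃ₗ[ℝ] N) (lam : N)
    (hw : ∀ v, (w : N ≃ᵃ[ℝ] N) v = wf (v + lam)) (i j : ι) (m k : ℤ) :
    P.MapsAffineRoot w (i, m) (j, k) ↔
      (∀ v, P.root' j (wf v) = P.root' i v) ∧ (k : ℝ) = m + P.root' i lam := by
  simp only [MapsAffineRoot, affineRootFun, hw]
  constructor
  · intro h
    have h0 : (k : ℝ) = m + P.root' i lam := by simpa using h (-lam)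
    refine ⟨fun v => ?_, h0⟩
    have := h (v - lam)
    simp only [sub_add_cancel, map_sub, h0] at this
    linarith
  · rintro ⟨h1, h2⟩ v
    rw [h1, h2, map_add]
    ring

end AffineWeyl

section Ideals

variable {P : RootPairing ι ℝ M N} (b : P.Base)

/-- The affine root `α_i + m δ` is positive if `α_i` is positive and `m > 0`, or `α_i` is
negative and `m ≥ 0`. -/
def IsPosAffine (a : ι × ℤ) : Prop :=
  (b.IsPos a.1 ∧ 0 < a.2) ∨ (¬ b.IsPos a.1 ∧ 0 ≤ a.2)

/-- `N(w)`: the positive affine roots `a` such that `w⁻¹(a)` is negative. -/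
def inversionSet (w : P.affineWeylGroup) : Set (ι × ℤ) :=
  {a | IsPosAffine b a ∧ ∃ c, P.MapsAffineRoot w⁻¹ a c ∧ ¬ IsPosAffine b c}

/-- The support of `w`: the roots `α` with `α + m δ ∈ N(w)` for some `m`. -/
def affineSupp (w : P.affineWeylGroup) : Set ι :=
  {i | ∃ m : ℤ, (i, m) ∈ inversionSet b w}

/-- `θ = α_i` is the highest root: `θ - α` is a sum of simple roots for every root `α`. -/
def IsHighestRoot (i : ι) : Prop :=
  ∀ j, P.root i - P.root j ∈ AddSubmonoid.closure (P.root '' b.support)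

/-- The simple reflections of `W_a`: the reflections in the hyperplanes `⟨α, v⟩ = 0` for `α`
simple, and the reflection in `⟨θ, v⟩ = 1` for the highest root `θ`. -/
def simpleAffineReflections : Set P.affineWeylGroup :=
  {s | (∃ i ∈ b.support, s = P.affineReflection i 0) ∨
    ∃ i, IsHighestRoot b i ∧ s = P.affineReflection i 1}

/-- An (upper order) ideal of the set of positive roots. -/
structure IsRootIdeal (I : Set ι) : Prop where
  isPos : ∀ i ∈ I, b.IsPos i
  add_mem : ∀ i ∈ I, ∀ j, b.IsPos j → ∀ k, b.IsPos k → P.root k = P.root i + P.root j → k ∈ I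

/-- The ideal `I` contains no simple root. -/
def IsStrictlyPositive (I : Set ι) : Prop := ∀ i ∈ b.support, i ∉ I

/-- `ST(I)`: the elements of the affine Weyl group with support `I`. -/
def signType (I : Set ι) : Set P.affineWeylGroup :=
  {w | affineSupp b w = I}

/-- `w` is the unique element of maximal length of `ST(I)`: every other element of `ST(I)` is
strictly shorter. -/
def IsLongestInSignType (I : Set ι) (w : P.affineWeylGroup) : Prop :=
  w ∈ signType b I ∧ ∀ x ∈ signType b I, x ≠ w →
    wordLength (simpleAffineReflections b) x < wordLength (simpleAffineReflections b) w

end Ideals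

end RootPairing

/-! Let `p` be the point of the fundamental alcove at which all simple affine roots take the same
value. The affine roots in N(w) are those positive at `p` and negative at `w p`, and the length of
`w` is their number. For an ideal I, w lies in ST(I) only if `w p` is dominant, and then a positive
root α is in I exactly when ⟨α, w p⟩ > 1. So ST(I) is a dominant region of the Shi arrangement.

That (a) implies (b) is immediate: going up in Bruhat order increases length. For the converse, let
w satisfy (b). The core is `exists_isSumOutside`: if α > 0 and ⟨α, w p⟩ < m, then α is a sum of at
most m positive roots outside I. Given this, any x in ST(I) has ⟨β, x p⟩ ≤ 1 for each summand β, so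
⟨α, x p⟩ ≤ m. Hence an affine root over I that is not inverted by w is not inverted by x, and N(x) ⊆
N(w). Since N determines the element, every other x is strictly shorter. A simple root is a sum of
positive roots only trivially, so it lies outside I, which gives strict positivity.

The core is proved by induction on the height of w⁻¹(α + mδ), a positive affine root. If that root
is simple, condition (b) itself says α ∉ I (`notMem_of_mapsAffineRoot_simple`). Otherwise it is δ
plus a positive affine root, or a sum of two positive affine roots (`exists_decomposition`). The
hard case is when w carries one summand to an affine root with negative finite part. Then α appears
as a summand of a larger vector, and `IsSumOutside.exists_split` divides a decomposition of α + β
between α and β at the cost of one extra root. -/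

namespace RootPairing

variable {ι M N : Type*} [AddCommGroup M] [Module ℝ M] [AddCommGroup N] [Module ℝ N]
variable {P : RootPairing ι ℝ M N}

set_option linter.unusedSectionVars false

/-! ### Existence and uniqueness of the highest root. -/

section HighestRoot

/-- Makes height a linear functional, so that it can be evaluated on vectors that are not roots. -/
lemma exists_heightPoint [P.IsRootSystem] (b : P.Base) :
    ∃ ρ : N, ∀ i, P.root' i ρ = b.height i := by
  let f : M →ₗ[ℝ] ℝ := b.toWeightBasis.constr ℝ (fun _ => (1 : ℝ))
  obtain ⟨ρ, hρ⟩ := P.toLinearMap.flip.toPerfPair.surjective f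
  have h1 : ∀ x, P.toLinearMap x ρ = f x := fun x => by rw [← hρ]; rfl
  have h2 : ∀ i ∈ b.support, f (P.root i) = 1 := by
    intro i hi
    rw [← b.toWeightBasis_apply ⟨i, hi⟩]
    exact b.toWeightBasis.constr_basis ℝ (fun _ => (1 : ℝ)) ⟨i, hi⟩
  refine ⟨ρ, fun i => ?_⟩
  obtain ⟨c, -, -, hc⟩ := b.exists_root_eq_sum_int i
  rw [b.height_eq_sum hc]
  change P.toLinearMap (P.root i) ρ = _
  rw [h1, hc, map_sum, Int.cast_sum]
  refine Finset.sum_congr rfl fun j hj => ?_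
  rw [map_zsmul, h2 j hj]
  simp

lemma nonneg_of_mem_closure (b : P.Base) {ρ : N} (hρ : ∀ i, P.root' i ρ = b.height i) {x : M}
    (hx : x ∈ AddSubmonoid.closure (P.root '' b.support)) : 0 ≤ P.toLinearMap x ρ := by
  induction hx using AddSubmonoid.closure_induction with
  | mem x hx =>
    obtain ⟨j, hj, rfl⟩ := hx
    have := hρ j
    rw [b.height_one_of_mem_support hj] at this
    change 0 ≤ P.root' j ρ
    rw [this]; simp
  | zero => simp
  | add x y _ _ hx hy => simp only [map_add, LinearMap.add_apply]; positivity

lemma height_le_of_sub_mem_closure [P.IsRootSystem] (b : P.Base) {i j : ι}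
    (h : P.root j - P.root i ∈ AddSubmonoid.closure (P.root '' b.support)) :
    b.height i ≤ b.height j := by
  obtain ⟨ρ, hρ⟩ := exists_heightPoint b
  have h1 := nonneg_of_mem_closure b hρ h
  rw [map_sub, LinearMap.sub_apply] at h1
  change 0 ≤ P.root' j ρ - P.root' i ρ at h1
  rw [hρ, hρ] at h1
  exact_mod_cast sub_nonneg.mp h1

lemma isPos_iff_mem_closure [P.IsRootSystem] (b : P.Base) {i : ι} :
    b.IsPos i ↔ P.root i ∈ AddSubmonoid.closure (P.root '' b.support) := by
  obtain ⟨ρ, hρ⟩ := exists_heightPoint b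
  constructor
  · intro h
    refine (b.root_mem_or_neg_mem i).resolve_right fun h' => ?_
    have h1 := nonneg_of_mem_closure b hρ h'
    have h2 := hρ i
    have h3 : (0 : ℝ) < b.height i := by exact_mod_cast b.isPos_iff.mp h
    simp only [map_neg, LinearMap.neg_apply] at h1
    change P.toLinearMap (P.root i) ρ = _ at h2
    linarith
  · intro h
    have h1 := nonneg_of_mem_closure b hρ h
    have h2 : P.toLinearMap (P.root i) ρ = _ := hρ i
    rw [h2] at h1
    exact b.isPos_iff'.mpr (by exact_mod_cast h1)

variable [Fintype ι] [P.IsCrystallographic]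

lemma zero_lt_pairingIn_iff_rootForm (i j : ι) :
    0 < P.pairingIn ℤ i j ↔ 0 < P.RootForm (P.root i) (P.root j) := by
  have h := P.toInvariantForm.two_mul_apply_root_root i j
  simp only [toInvariantForm_form] at h
  have h2 : 0 < P.RootForm (P.root j) (P.root j) :=
    P.rootForm_pos_of_ne_zero (Submodule.subset_span ⟨j, rfl⟩) (P.ne_zero j)
  have h3 : (P.pairingIn ℤ i j : ℝ) = P.pairing i j := P.algebraMap_pairingIn ℤ i j
  rw [← Int.cast_pos (R := ℝ), h3]
  constructor
  · intro h4; nlinarith [mul_pos h4 h2]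
  · intro h4; by_contra! h5; nlinarith

lemma rootForm_comm (x y : M) : P.RootForm x y = P.RootForm y x :=
  P.rootForm_symmetric.eq x y

lemma root_sub_root_mem_of_rootForm_pos {i j : ι} (h : 0 < P.RootForm (P.root i) (P.root j))
    (hij : i ≠ j) : ∃ k, P.root k = P.root i - P.root j :=
  P.root_sub_root_mem_of_pairingIn_pos ((zero_lt_pairingIn_iff_rootForm i j).mpr h) hij

lemma root_add_root_mem_of_rootForm_neg {i j : ι} (h : P.RootForm (P.root i) (P.root j) < 0)
    (hij : P.root i ≠ -P.root j) : ∃ k, P.root k = P.root i + P.root j := by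
  refine P.root_add_root_mem_of_pairingIn_neg ?_ hij
  have h1 := (zero_lt_pairingIn_iff_rootForm (P := P) i (P.reflectionPerm j j)).mpr
    (by simpa using h)
  simpa using h1

lemma exists_rootForm_pos_of_multiset_sum (m : Multiset M) (x : M) (h : 0 < P.RootForm x m.sum) :
    ∃ y ∈ m, 0 < P.RootForm x y := by
  by_contra! hc
  induction m using Multiset.induction with
  | empty => simp at h
  | cons a m ih =>
    simp only [Multiset.sum_cons, map_add] at h
    have := hc a (by simp)
    exact ih (by linarith) fun y hy => hc y (by simp [hy])

variable [P.IsRootSystem]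

lemma rootForm_self_pos {x : M} (hx : x ≠ 0) : 0 < P.RootForm x x :=
  P.rootForm_pos_of_ne_zero (by simp) hx

lemma exists_sub_simple_mem_closure (b : P.Base) {x : M}
    (hx : x ∈ AddSubmonoid.closure (P.root '' b.support)) (h0 : x ≠ 0) :
    ∃ i ∈ b.support, 0 < P.RootForm x (P.root i) ∧
      x - P.root i ∈ AddSubmonoid.closure (P.root '' b.support) := by
  classical
  obtain ⟨m, hm, rfl⟩ := AddSubmonoid.exists_multiset_of_mem_closure hx
  obtain ⟨y, hy, hy'⟩ := exists_rootForm_pos_of_multiset_sum m m.sum (rootForm_self_pos (P := P) h0)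
  obtain ⟨i, hi, rfl⟩ := hm y hy
  refine ⟨i, hi, hy', ?_⟩
  have : m.sum - P.root i = (m.erase (P.root i)).sum := by
    rw [← Multiset.sum_erase hy]; abel
  rw [this]
  exact AddSubmonoid.multiset_sum_mem _ _ fun z hz =>
    AddSubmonoid.subset_closure (hm z (Multiset.mem_of_mem_erase hz))

/-- A root is dominant if it pairs non-negatively with the simple roots. -/
def IsDominantRoot (b : P.Base) (i : ι) : Prop :=
  ∀ j ∈ b.support, 0 ≤ P.RootForm (P.root i) (P.root j)

lemma IsDominantRoot.rootForm_nonneg {b : P.Base} {i : ι} (h : IsDominantRoot b i) {x : M}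
    (hx : x ∈ AddSubmonoid.closure (P.root '' b.support)) : 0 ≤ P.RootForm (P.root i) x := by
  induction hx using AddSubmonoid.closure_induction with
  | mem x hx => obtain ⟨j, hj, rfl⟩ := hx; exact h j hj
  | zero => simp
  | add x y _ _ hx hy => rw [map_add]; positivity

/-- A positive root is top if adding a simple root to it never yields a root. -/
def IsTopRoot (b : P.Base) (i : ι) : Prop :=
  b.IsPos i ∧ ∀ j ∈ b.support, ∀ k, P.root k ≠ P.root i + P.root j

lemma IsTopRoot.isDominantRoot {b : P.Base} {i : ι} (h : IsTopRoot b i) : IsDominantRoot b i := by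
  intro j hj
  by_contra! hc
  obtain ⟨k, hk⟩ := root_add_root_mem_of_rootForm_neg hc (fun he => by
    have h1 : b.height i = - b.height j := by
      let := P.indexNeg
      have : i = -j := P.root.injective (by simpa using he)
      rw [this, b.height_reflectionPerm_self]
    have h2 := b.isPos_iff.mp h.1
    rw [b.height_one_of_mem_support hj] at h1
    omega)
  exact h.2 j hj k hk

/-- A dominant root has full support. A simple root missing from the sum pairs non-positively with
every term but non-negatively with the total, so it is orthogonal to all terms. The span of the
simple roots that occur is then stable under every simple reflection, hence everything by
irreducibility. -/
lemma IsDominantRoot.simple_mem_of_multiset_sum [P.IsReduced] [P.IsIrreducible] {b : P.Base}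
    {i : ι} (h : IsDominantRoot b i) (m : Multiset M) (hm : ∀ y ∈ m, y ∈ P.root '' b.support)
    (hi : P.root i = m.sum) {j : ι} (hj : j ∈ b.support) : P.root j ∈ m := by
  classical
  let s : Set ι := {k | k ∈ b.support ∧ P.root k ∈ m}
  have orth : ∀ k ∈ b.support, k ∉ s → ∀ l ∈ s, P.RootForm (P.root k) (P.root l) = 0 := by
    intro k hk hks l hl
    have hnonpos : ∀ y ∈ m, P.RootForm (P.root k) y ≤ 0 := by
      intro y hy
      obtain ⟨l, hl, rfl⟩ := hm y hy
      have hkl : k ≠ l := by rintro rfl; exact hks ⟨hk, hy⟩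
      have := b.pairingIn_le_zero_of_ne hkl hk hl
      by_contra! hc
      have := (zero_lt_pairingIn_iff_rootForm k l).mpr hc
      omega
    refine le_antisymm (hnonpos _ hl.2) ?_
    have h0 := h k hk
    rw [rootForm_comm, hi, ← Multiset.sum_erase hl.2, map_add] at h0
    have : P.RootForm (P.root k) (m.erase (P.root l)).sum ≤ 0 := by
      by_contra! hc
      obtain ⟨y, hy, hy'⟩ := exists_rootForm_pos_of_multiset_sum _ _ hc
      linarith [hnonpos y (Multiset.mem_of_mem_erase hy)]
    linarith
  have hne : m ≠ 0 := by rintro rfl; exact P.ne_zero i (by simpa using hi)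
  have hq : ∀ k, Submodule.span ℝ (P.root '' s) ∈ Module.End.invtSubmodule (P.reflection k) := by
    rw [← b.forall_mem_support_invtSubmodule_iff]
    intro k hk
    by_cases hks : k ∈ s
    · exact Submodule.mem_invtSubmodule_reflection_of_mem _ _ (Submodule.subset_span ⟨k, hks, rfl⟩)
    · refine (Module.End.mem_invtSubmodule _).mpr fun x hx => ?_
      have hfix : Function.IsFixedPt (P.reflection k) x := by
        refine isFixedPt_reflection_of_isOrthogonal (s := s) (fun l hl => ?_) hx
        have := orth k hk hks l hl
        have h1 := (P.toInvariantForm.apply_root_root_zero_iff k l).mp this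
        have h2 := (P.toInvariantForm.apply_root_root_zero_iff l k).mp
          (by simpa [rootForm_comm] using this)
        exact ⟨h1, h2⟩
      rw [Submodule.mem_comap, LinearEquiv.coe_coe, hfix.eq]
      exact hx
  have htop : Submodule.span ℝ (P.root '' s) = ⊤ := by
    refine IsIrreducible.eq_top_of_invtSubmodule_reflection (P := P) _ hq ?_
    obtain ⟨y, hy⟩ := Multiset.exists_mem_of_ne_zero hne
    obtain ⟨k, hk, rfl⟩ := hm y hy
    simpa using ⟨k, ⟨hk, hy⟩, P.ne_zero k⟩
  by_contra hjm
  have hjs : j ∉ s := fun hh => hjm hh.2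
  have hsub : s ⊆ (b.support : Set ι) \ {j} := fun k hk =>
    ⟨hk.1, by rintro rfl; exact hjs hk⟩
  refine b.linearIndepOn_root.notMem_span hj ?_
  exact Submodule.span_mono (Set.image_mono hsub) (htop ▸ Submodule.mem_top)

/-- The second root pairs positively with some simple root, which occurs in the first by full
support; the other terms contribute non-negatively. -/
lemma IsDominantRoot.rootForm_pos [P.IsReduced] [P.IsIrreducible] {b : P.Base} {i j : ι}
    (hi : IsDominantRoot b i) (hj : IsDominantRoot b j) (hip : b.IsPos i) (hjp : b.IsPos j) :
    0 < P.RootForm (P.root i) (P.root j) := by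
  obtain ⟨k, hk, hk'⟩ : ∃ k ∈ b.support, 0 < P.RootForm (P.root j) (P.root k) := by
    obtain ⟨k, hk, hk', -⟩ :=
      exists_sub_simple_mem_closure b ((isPos_iff_mem_closure b).mp hjp) (P.ne_zero j)
    exact ⟨k, hk, hk'⟩
  obtain ⟨m, hm, hi'⟩ :=
    AddSubmonoid.exists_multiset_of_mem_closure ((isPos_iff_mem_closure b).mp hip)
  have hkm := hi.simple_mem_of_multiset_sum m hm hi'.symm hk
  obtain ⟨m', rfl⟩ := Multiset.exists_cons_of_mem hkm
  rw [rootForm_comm, ← hi', Multiset.sum_cons, map_add]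
  refine add_pos_of_pos_of_nonneg hk' (hj.rootForm_nonneg ?_)
  exact AddSubmonoid.multiset_sum_mem _ _ fun z hz =>
    AddSubmonoid.subset_closure (hm z (Multiset.mem_cons_of_mem hz))

/-- From a root strictly above a top root one can subtract a simple root and stay above it.
Descending by height, one reaches the top root plus a simple root, a contradiction. -/
lemma IsTopRoot.eq_of_sub_mem_closure {b : P.Base} {i : ι} (h : IsTopRoot b i) {j : ι}
    (hj : P.root j - P.root i ∈ AddSubmonoid.closure (P.root '' b.support)) : j = i := by
  by_contra hne
  generalize hN : (b.height j - b.height i).toNat = n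
  induction n using Nat.strong_induction_on generalizing j with
  | _ n ih =>
    have hx0 : P.root j - P.root i ≠ 0 := fun h0 => hne (P.root.injective (sub_eq_zero.mp h0))
    obtain ⟨k, hk, hk1, hk2⟩ := exists_sub_simple_mem_closure b hj hx0
    have hik := h.isDominantRoot k hk
    rw [map_sub, LinearMap.sub_apply] at hk1
    have hjk : 0 < P.RootForm (P.root j) (P.root k) := by linarith
    have hheight : b.height i + 1 ≤ b.height j := by
      obtain ⟨ρ, hρ⟩ := exists_heightPoint b
      have h1 := nonneg_of_mem_closure b hρ hk2
      simp only [map_sub, LinearMap.sub_apply] at h1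
      change 0 ≤ P.root' j ρ - P.root' i ρ - P.root' k ρ at h1
      rw [hρ, hρ, hρ, b.height_one_of_mem_support hk] at h1
      have h2 : (b.height i + 1 : ℝ) ≤ b.height j := by push_cast at h1; linarith
      exact_mod_cast h2
    have hjk' : j ≠ k := by
      rintro rfl
      rw [b.height_one_of_mem_support hk] at hheight
      have := b.isPos_iff.mp h.1
      omega
    obtain ⟨l, hl⟩ := root_sub_root_mem_of_rootForm_pos hjk hjk'
    have hlj : b.height l = b.height j - 1 := by
      rw [b.height_sub hl, b.height_one_of_mem_support hk]
    by_cases hli : l = i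
    · subst hli
      exact h.2 k hk j (by rw [hl]; abel)
    · exact ih _ (by omega) (j := l) (by rw [hl]; convert! hk2 using 1; abel) hli rfl

/-- Distinct top roots would pair positively, so their difference would be a root and one would lie
above the other. -/
lemma IsTopRoot.eq [P.IsReduced] [P.IsIrreducible] {b : P.Base} {i j : ι}
    (hi : IsTopRoot b i) (hj : IsTopRoot b j) : i = j := by
  by_contra hne
  obtain ⟨k, hk⟩ := root_sub_root_mem_of_rootForm_pos
    (hi.isDominantRoot.rootForm_pos hj.isDominantRoot hi.1 hj.1) hne
  rcases b.root_mem_or_neg_mem k with h | h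
  · exact hne (hj.eq_of_sub_mem_closure (by rwa [hk] at h))
  · exact hne (hi.eq_of_sub_mem_closure (by rwa [hk, neg_sub] at h)).symm

lemma exists_isTopRoot_sub_mem_closure (b : P.Base) {i : ι} (hi : b.IsPos i) :
    ∃ j, IsTopRoot b j ∧ P.root j - P.root i ∈ AddSubmonoid.closure (P.root '' b.support) := by
  obtain ⟨j, hj, hmax⟩ := Set.exists_max_image
    {j | P.root j - P.root i ∈ AddSubmonoid.closure (P.root '' b.support)} b.height
    (Set.toFinite _) ⟨i, by simp⟩
  have hjp : b.IsPos j := by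
    rw [isPos_iff_mem_closure]
    simpa using add_mem hj ((isPos_iff_mem_closure b).mp hi)
  refine ⟨j, ⟨hjp, fun k hk l hl => ?_⟩, hj⟩
  have h1 : b.height l ≤ b.height j := hmax l (by
    change P.root l - P.root i ∈ AddSubmonoid.closure (P.root '' b.support)
    rw [hl, add_sub_right_comm]
    exact add_mem hj (AddSubmonoid.subset_closure ⟨k, hk, rfl⟩))
  rw [b.height_add hl, b.height_one_of_mem_support hk] at h1
  omega

lemma IsTopRoot.isHighestRoot [P.IsReduced] [P.IsIrreducible] {b : P.Base} {i : ι}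
    (h : IsTopRoot b i) : IsHighestRoot b i := by
  intro j
  by_cases hj : b.IsPos j
  · obtain ⟨k, hk, hk'⟩ := exists_isTopRoot_sub_mem_closure b hj
    rwa [h.eq hk]
  · have h1 := (b.root_mem_or_neg_mem j).resolve_left (by rwa [← isPos_iff_mem_closure])
    rw [sub_eq_add_neg]
    exact add_mem ((isPos_iff_mem_closure b).mp h.1) h1

lemma exists_isHighestRoot [P.IsReduced] [P.IsIrreducible] (b : P.Base) :
    ∃ θ, IsHighestRoot b θ := by
  obtain ⟨i, hi⟩ : ∃ i, b.IsPos i := by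
    have : Nonempty ι := by
      by_contra! hι
      have h1 : Submodule.span ℝ (Set.range P.root) = ⊤ := IsRootSystem.span_root_eq_top
      have := IsIrreducible.nontrivial P
      rw [Set.range_eq_empty, Submodule.span_empty] at h1
      exact bot_ne_top h1
    obtain ⟨i, hi⟩ := b.support_nonempty
    exact ⟨i, b.isPos_of_mem_support hi⟩
  obtain ⟨j, hj, -⟩ := exists_isTopRoot_sub_mem_closure b hi
  exact ⟨j, hj.isHighestRoot⟩

lemma IsHighestRoot.height_le {b : P.Base} {θ : ι} (h : IsHighestRoot b θ) (i : ι) :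
    b.height i ≤ b.height θ :=
  height_le_of_sub_mem_closure b (h i)

lemma IsHighestRoot.isPos {b : P.Base} {θ : ι} (h : IsHighestRoot b θ) : b.IsPos θ := by
  let := P.indexNeg
  have h1 := h.height_le (-θ)
  rw [b.height_reflectionPerm_self] at h1
  exact b.isPos_iff'.mpr (by omega)

lemma IsHighestRoot.isTopRoot {b : P.Base} {θ : ι} (h : IsHighestRoot b θ) : IsTopRoot b θ := by
  refine ⟨h.isPos, fun j hj k hk => ?_⟩
  have h1 := h.height_le k
  rw [b.height_add hk, b.height_one_of_mem_support hj] at h1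
  omega

lemma IsHighestRoot.eq [P.IsReduced] [P.IsIrreducible] {b : P.Base} {i j : ι}
    (hi : IsHighestRoot b i) (hj : IsHighestRoot b j) : i = j :=
  hi.isTopRoot.eq hj.isTopRoot

lemma IsHighestRoot.eq_of_height_le {b : P.Base} {θ : ι}
    (h : IsHighestRoot b θ) {i : ι} (hi : b.height θ ≤ b.height i) : i = θ := by
  by_contra hne
  obtain ⟨k, hk, -, hk'⟩ := exists_sub_simple_mem_closure b (h i)
    (fun h0 => hne (P.root.injective (sub_eq_zero.mp h0)).symm)
  obtain ⟨ρ, hρ⟩ := exists_heightPoint b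
  have h1 := nonneg_of_mem_closure b hρ hk'
  simp only [map_sub, LinearMap.sub_apply] at h1
  change 0 ≤ P.root' θ ρ - P.root' i ρ - P.root' k ρ at h1
  rw [hρ, hρ, hρ, b.height_one_of_mem_support hk] at h1
  have h2 : (b.height i + 1 : ℝ) ≤ b.height θ := by push_cast at h1; linarith
  have h3 : b.height i + 1 ≤ b.height θ := by exact_mod_cast h2
  omega

end HighestRoot

/-! ### Affine roots as functionals, and the action of the affine Weyl group. -/

section AffineRoots

/-- The negative of an affine root. -/
def affineNeg (P : RootPairing ι ℝ M N) (a : ι × ℤ) : ι × ℤ := (P.reflectionPerm a.1 a.1, -a.2)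

lemma root'_reflectionPerm_self (i : ι) (v : N) :
    P.root' (P.reflectionPerm i i) v = -P.root' i v := by
  simp [root']

lemma affineRootFun_affineNeg (a : ι × ℤ) (v : N) :
    P.affineRootFun (P.affineNeg a) v = -P.affineRootFun a v := by
  simp only [affineRootFun, affineNeg, root'_reflectionPerm_self]
  push_cast
  ring

lemma affineRootFun_injective {a c : ι × ℤ}
    (h : ∀ v, P.affineRootFun a v = P.affineRootFun c v) : a = c := by
  have h0 : (a.2 : ℝ) = c.2 := by simpa [affineRootFun] using h 0
  have h1 : P.root a.1 = P.root c.1 := by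
    apply P.toLinearMap.toPerfPair.injective
    ext v
    have := h v
    simp only [affineRootFun, h0] at this
    change P.root' a.1 v = P.root' c.1 v
    linarith
  exact Prod.ext (P.root.injective h1) (by exact_mod_cast h0)

lemma coe_affineReflection_apply (a : ι × ℤ) (v : N) :
    (P.affineReflection a.1 a.2 : N ≃ᵃ[ℝ] N) v = v + P.affineRootFun a v • P.coroot a.1 := by
  rw [affineReflection_apply, affineRootFun, sub_eq_add_neg, ← neg_smul]
  congr 2
  ring

lemma affineWeylGroup_ext {x y : P.affineWeylGroup}
    (h : ∀ v, (x : N ≃ᵃ[ℝ] N) v = (y : N ≃ᵃ[ℝ] N) v) : x = y :=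
  Subtype.ext (AffineEquiv.ext h)

lemma coe_mul_apply (x y : P.affineWeylGroup) (v : N) :
    ((x * y : P.affineWeylGroup) : N ≃ᵃ[ℝ] N) v = (x : N ≃ᵃ[ℝ] N) ((y : N ≃ᵃ[ℝ] N) v) := rfl

lemma coe_apply_coe_inv_apply (x : P.affineWeylGroup) (v : N) :
    (x : N ≃ᵃ[ℝ] N) (((x⁻¹ : P.affineWeylGroup) : N ≃ᵃ[ℝ] N) v) = v := by
  rw [← coe_mul_apply, mul_inv_cancel]; rfl

lemma coe_inv_apply_coe_apply (x : P.affineWeylGroup) (v : N) :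
    ((x⁻¹ : P.affineWeylGroup) : N ≃ᵃ[ℝ] N) ((x : N ≃ᵃ[ℝ] N) v) = v := by
  rw [← coe_mul_apply, inv_mul_cancel]; rfl

lemma affineRootFun_affineReflection_self (a : ι × ℤ) (v : N) :
    P.affineRootFun a ((P.affineReflection a.1 a.2 : N ≃ᵃ[ℝ] N) v) = -P.affineRootFun a v := by
  rw [coe_affineReflection_apply]
  simp only [affineRootFun, map_add, map_smul, smul_eq_mul, root'_coroot_eq_pairing, pairing_same]
  ring

lemma affineReflection_mul_self (a : ι × ℤ) :
    P.affineReflection a.1 a.2 * P.affineReflection a.1 a.2 = 1 := by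
  refine affineWeylGroup_ext fun v => ?_
  rw [coe_mul_apply, coe_affineReflection_apply, affineRootFun_affineReflection_self,
    coe_affineReflection_apply, add_assoc, ← add_smul]
  simp

lemma affineReflection_inv (a : ι × ℤ) :
    (P.affineReflection a.1 a.2)⁻¹ = P.affineReflection a.1 a.2 :=
  inv_eq_of_mul_eq_one_left (affineReflection_mul_self a)

lemma coroot_reflectionPerm_self (i : ι) : P.coroot (P.reflectionPerm i i) = -P.coroot i := by
  simp

lemma affineReflection_affineNeg (a : ι × ℤ) :
    P.affineReflection (P.affineNeg a).1 (P.affineNeg a).2 = P.affineReflection a.1 a.2 := by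
  refine affineWeylGroup_ext fun v => ?_
  rw [coe_affineReflection_apply, coe_affineReflection_apply, affineRootFun_affineNeg]
  simp only [affineNeg]
  rw [coroot_reflectionPerm_self, neg_smul_neg]

lemma coe_apply_add (w : P.affineWeylGroup) (x y : N) :
    (w : N ≃ᵃ[ℝ] N) (x + y) = (w : N ≃ᵃ[ℝ] N).linear y + (w : N ≃ᵃ[ℝ] N) x := by
  have := (w : N ≃ᵃ[ℝ] N).map_vadd x y
  rwa [vadd_eq_add, vadd_eq_add, add_comm] at this

lemma exists_root'_comp_of_mem_weylGroup {g : N ≃ₗ[ℝ] N} (hg : g ∈ P.weylGroupOnCoweights)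
    (i : ι) : ∃ j, (∀ v, P.root' j (g v) = P.root' i v) ∧ g (P.coroot i) = P.coroot j := by
  have key : ∀ k i, ∃ j, (∀ v, P.root' j (P.coreflection k v) = P.root' i v) ∧
      P.coreflection k (P.coroot i) = P.coroot j := fun k i => by
    refine ⟨P.reflectionPerm k i, fun v => ?_, (P.coroot_reflectionPerm k i).symm⟩
    rw [root', root_reflectionPerm, reflection_apply, coreflection_apply]
    simp only [map_sub, map_smul, LinearMap.sub_apply, LinearMap.smul_apply, smul_eq_mul]
    change P.root' i v - P.pairing i k * P.root' k v -
      P.root' k v * (P.pairing i k - P.pairing i k * P.pairing k k) = P.root' i v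
    rw [pairing_same]
    ring
  induction hg using Subgroup.closure_induction'' generalizing i with
  | one => exact ⟨i, fun v => rfl, rfl⟩
  | mem g hg => obtain ⟨k, rfl⟩ := hg; exact key k i
  | inv_mem g hg => obtain ⟨k, rfl⟩ := hg; rw [coreflection_inv]; exact key k i
  | mul g h _ _ hg hh =>
    obtain ⟨j, hj, hj'⟩ := hh i
    obtain ⟨k, hk, hk'⟩ := hg j
    exact ⟨k, fun v => (hk _).trans (hj v), (congrArg g hj').trans hk'⟩

variable [P.IsCrystallographic]

lemma exists_int_of_mem_corootSpan (i : ι) {x : N} (hx : x ∈ P.corootSpan ℤ) :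
    ∃ m : ℤ, P.root' i x = m := by
  induction hx using Submodule.span_induction with
  | mem x hx =>
    obtain ⟨j, rfl⟩ := hx
    exact ⟨P.pairingIn ℤ i j, (P.algebraMap_pairingIn ℤ i j).symm⟩
  | zero => exact ⟨0, by simp⟩
  | add x y _ _ hx hy =>
    obtain ⟨m, hm⟩ := hx
    obtain ⟨k, hk⟩ := hy
    exact ⟨m + k, by rw [map_add, hm, hk]; push_cast; ring⟩
  | smul n x _ hx =>
    obtain ⟨m, hm⟩ := hx
    exact ⟨n * m, by rw [map_zsmul, hm]; simp⟩

lemma exists_mapsAffineRoot (w : P.affineWeylGroup) (a : ι × ℤ) :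
    ∃ c, P.MapsAffineRoot w a c ∧
      w * P.affineReflection a.1 a.2 * w⁻¹ = P.affineReflection c.1 c.2 := by
  obtain ⟨j, hj, hj'⟩ := exists_root'_comp_of_mem_weylGroup w.2.1 a.1
  obtain ⟨m, hm⟩ := exists_int_of_mem_corootSpan j w.2.2
  have hmap : P.MapsAffineRoot w a (j, a.2 + m) := by
    intro v
    have hv := coe_apply_add w 0 v
    rw [zero_add] at hv
    rw [hv]
    simp only [affineRootFun, map_add, hj]
    rw [hm]
    push_cast
    ring
  refine ⟨_, hmap, affineWeylGroup_ext fun v => ?_⟩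
  rw [coe_mul_apply, coe_mul_apply, coe_affineReflection_apply, coe_apply_add,
    coe_affineReflection_apply, map_smul, hj', coe_apply_coe_inv_apply, add_comm]
  congr 2
  have := hmap (((w⁻¹ : P.affineWeylGroup) : N ≃ᵃ[ℝ] N) v)
  rw [coe_apply_coe_inv_apply] at this
  exact this.symm

lemma affineRootFun_comp_affineReflection (a d : ι × ℤ) (v : N) :
    P.affineRootFun a ((P.affineReflection d.1 d.2 : N ≃ᵃ[ℝ] N) v) =
      P.affineRootFun (P.reflectionPerm d.1 a.1, a.2 - d.2 * P.pairingIn ℤ a.1 d.1) v := by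
  have hp : (P.pairingIn ℤ a.1 d.1 : ℝ) = P.pairing a.1 d.1 := P.algebraMap_pairingIn ℤ _ _
  rw [coe_affineReflection_apply]
  simp only [affineRootFun, map_add, map_smul, smul_eq_mul]
  rw [root'_coroot_eq_pairing]
  rw [root', root', root', root_reflectionPerm, reflection_apply]
  simp only [map_sub, map_smul, LinearMap.sub_apply, LinearMap.smul_apply, smul_eq_mul,
    root_coroot'_eq_pairing]
  push_cast
  rw [hp]
  ring

end AffineRoots

/-! ### The centre of the fundamental alcove and positivity of affine roots. -/

section Alcove

/-- A point of the fundamental alcove at which all simple affine roots take the same value,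
together with the highest root. -/
structure AlcoveCenter (b : P.Base) where
  /-- The index of the highest root. -/
  θ : ι
  isHighestRoot : IsHighestRoot b θ
  /-- The point. -/
  point : N
  height_eq : ∀ i, (b.height θ + 1 : ℝ) * P.root' i point = b.height i

variable {b : P.Base}

lemma nonempty_alcoveCenter [Fintype ι] [P.IsCrystallographic] [P.IsRootSystem] [P.IsReduced]
    [P.IsIrreducible] (b : P.Base) : Nonempty (AlcoveCenter b) := by
  obtain ⟨θ, hθ⟩ := exists_isHighestRoot b
  obtain ⟨ρ, hρ⟩ := exists_heightPoint b
  refine ⟨θ, hθ, (b.height θ + 1 : ℝ)⁻¹ • ρ, fun i => ?_⟩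
  have : (0 : ℝ) < b.height θ := by exact_mod_cast b.isPos_iff.mp hθ.isPos
  rw [map_smul, hρ, smul_eq_mul, mul_inv_cancel_left₀ (by positivity)]

namespace AlcoveCenter

variable (c : AlcoveCenter b)

/-- The height of an affine root. -/
noncomputable def affineHeight (a : ι × ℤ) : ℤ := a.2 * (b.height c.θ + 1) - b.height a.1

lemma affineHeight_eq (a : ι × ℤ) :
    (c.affineHeight a : ℝ) = (b.height c.θ + 1) * P.affineRootFun a c.point := by
  simp only [affineHeight, affineRootFun, mul_sub, c.height_eq]
  push_cast
  ring

/-- The simple affine roots. -/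
def simpleRoots : Set (ι × ℤ) :=
  {a | (∃ i ∈ b.support, a = (P.reflectionPerm i i, 0)) ∨ a = (c.θ, 1)}

variable [Fintype ι] [P.IsCrystallographic] [P.IsRootSystem]

lemma height_pos : 0 < b.height c.θ := b.isPos_iff.mp c.isHighestRoot.isPos

lemma affineHeight_pos_iff (a : ι × ℤ) :
    0 < c.affineHeight a ↔ 0 < P.affineRootFun a c.point := by
  have h : (0 : ℝ) < b.height c.θ := by exact_mod_cast c.height_pos
  rw [← Int.cast_pos (R := ℝ), affineHeight_eq]
  exact mul_pos_iff_of_pos_left (by positivity)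

lemma neg_height_le (i : ι) : -b.height c.θ ≤ b.height i := by
  let := P.indexNeg
  have := c.isHighestRoot.height_le (-i)
  rw [b.height_reflectionPerm_self] at this
  omega

/-- Root heights are nonzero and bounded by that of θ in absolute value, so the sign of m(ht θ + 1)
− ht α is decided by m, and by the sign of α when m = 0. -/
lemma isPosAffine_iff (a : ι × ℤ) : IsPosAffine b a ↔ 0 < P.affineRootFun a c.point := by
  rw [← affineHeight_pos_iff, affineHeight]
  have h1 := c.isHighestRoot.height_le a.1
  have h2 := c.neg_height_le a.1
  have h3 := c.height_pos
  have h4 := b.height_ne_zero a.1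
  simp only [IsPosAffine, b.isPos_iff]
  constructor
  · rintro (⟨h5, h6⟩ | ⟨h5, h6⟩)
    · nlinarith
    · nlinarith [lt_of_le_of_ne (not_lt.mp h5) h4]
  · intro h5
    by_contra! hc
    rcases lt_or_gt_of_ne h4 with h6 | h6
    · nlinarith [hc.2 (by omega)]
    · nlinarith [hc.1 h6]

lemma affineRootFun_ne_zero (a : ι × ℤ) : P.affineRootFun a c.point ≠ 0 := by
  intro h
  have h1 := (c.isPosAffine_iff a).not.mpr (by rw [h]; simp)
  have h2 := (c.isPosAffine_iff (P.affineNeg a)).not.mpr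
    (by rw [affineRootFun_affineNeg, h]; simp)
  let := P.indexNeg
  have h3 := b.height_ne_zero a.1
  have h4 := b.height_reflectionPerm_self a.1
  simp only [IsPosAffine, affineNeg, b.isPos_iff] at h1 h2
  change b.height (P.reflectionPerm a.1 a.1) = _ at h4
  rw [h4] at h2
  omega

lemma affineRootFun_comp_ne_zero (w : P.affineWeylGroup) (a : ι × ℤ) :
    P.affineRootFun a ((w : N ≃ᵃ[ℝ] N) c.point) ≠ 0 := by
  obtain ⟨d, hd, -⟩ := exists_mapsAffineRoot w⁻¹ a
  have := hd ((w : N ≃ᵃ[ℝ] N) c.point)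
  rw [coe_inv_apply_coe_apply] at this
  rw [← this]
  exact c.affineRootFun_ne_zero d

lemma affineHeight_simpleRoot {d : ι × ℤ} (hd : d ∈ c.simpleRoots) : c.affineHeight d = 1 := by
  rcases hd with ⟨i, hi, rfl⟩ | rfl
  · let := P.indexNeg
    have h1 := b.height_reflectionPerm_self i
    change b.height (P.reflectionPerm i i) = _ at h1
    simp [affineHeight, h1, b.height_one_of_mem_support hi]
  · simp [affineHeight]

lemma simpleRoot_pos {d : ι × ℤ} (hd : d ∈ c.simpleRoots) : 0 < P.affineRootFun d c.point := by
  rw [← affineHeight_pos_iff, c.affineHeight_simpleRoot hd]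
  exact one_pos

variable [P.IsReduced]

/-- A simple reflection permutes the positive affine roots other than its own. For the finite ones
this is the classical fact about simple reflections; for s₀ it follows from an invariant of the
reflection. -/
lemma affineReflection_pos {d a : ι × ℤ} (hd : d ∈ c.simpleRoots)
    (ha : 0 < P.affineRootFun a c.point) (had : a ≠ d) :
    0 < P.affineRootFun a ((P.affineReflection d.1 d.2 : N ≃ᵃ[ℝ] N) c.point) := by
  rw [affineRootFun_comp_affineReflection, ← isPosAffine_iff]
  rw [← isPosAffine_iff] at ha
  rcases hd with ⟨i, hi, rfl⟩ | rfl
  · have e : P.reflectionPerm (P.reflectionPerm i i) a.1 = P.reflectionPerm i a.1 := by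
      apply P.root.injective
      simp [root_reflectionPerm, reflection_apply]
      module
    simp only [zero_mul, sub_zero, e]
    by_cases h0 : 0 < a.2
    · exact (em _).imp (fun h => ⟨h, h0⟩) fun h => ⟨h, h0.le⟩
    · have ha' : ¬ b.IsPos a.1 ∧ 0 ≤ a.2 := by
        rcases ha with h | h
        · exact absurd h.2 h0
        · exact h
      refine Or.inr ⟨fun hp => ?_, ha'.2⟩
      have hne : P.reflectionPerm i a.1 ≠ i := by
        intro h
        apply had
        refine Prod.ext ?_ (le_antisymm (not_lt.mp h0) ha'.2)
        rw [← P.reflectionPerm_self i a.1, h]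
      have := hp.reflectionPerm hi hne
      rw [P.reflectionPerm_self] at this
      exact ha'.1 this
  · have hroot : P.root (P.reflectionPerm c.θ a.1) =
        P.root a.1 + (-P.pairingIn ℤ a.1 c.θ) • P.root c.θ := by
      rw [root_reflectionPerm, neg_smul, reflection_apply_root' ℤ, sub_eq_add_neg]
    have hh := b.height_add_zsmul hroot
    have h1 := c.isHighestRoot.height_le a.1
    have h2 := c.neg_height_le (P.reflectionPerm c.θ a.1)
    have h3 := c.height_pos
    have h4 := b.height_ne_zero a.1
    have h5 := b.height_ne_zero (P.reflectionPerm c.θ a.1)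
    have hlt : a.2 = 1 → b.height a.1 < b.height c.θ := by
      intro h6
      refine lt_of_le_of_ne h1 fun h => had (Prod.ext ?_ h6)
      exact c.isHighestRoot.eq_of_height_le h.ge
    simp only [IsPosAffine, b.isPos_iff] at ha ⊢
    generalize b.height (P.reflectionPerm c.θ a.1) = x at *
    generalize b.height a.1 = y at *
    generalize P.pairingIn ℤ a.1 c.θ = p at *
    generalize b.height c.θ = T at *
    generalize a.2 = m at *
    simp only [smul_eq_mul, one_mul] at hh ⊢
    -- With T = ht θ, the quantity mT − ht α is T times the value at a point of the wall ⟨θ, v⟩ = 1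
    -- and so is fixed by s₀. It is positive for positive affine roots other than θ + δ, and at most
    -- 0 for negative ones.
    have hE : (m - p) * T - x = m * T - y := by rw [hh]; ring
    by_contra! hc
    have hle : (m - p) * T - x ≤ 0 := by
      rcases lt_or_gt_of_ne h5 with h6 | h6
      · nlinarith [hc.2 (by omega)]
      · nlinarith [hc.1 h6]
    have hneg : 0 < x → (m - p) * T - x < 0 := fun h6 => by nlinarith [hc.1 h6]
    rcases ha with ⟨h6, h7⟩ | ⟨h6, h7⟩
    · rcases eq_or_lt_of_le (show 1 ≤ m by omega) with h8 | h8
      · have := hlt h8.symm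
        subst h8
        linarith
      · nlinarith
    · have : 0 ≤ m * T := by positivity
      omega

end AlcoveCenter

end Alcove

/-! ### Inversion sets, generation by simple reflections, and the length formula. -/

section Length

variable {b : P.Base}
variable [Fintype ι] [P.IsCrystallographic] [P.IsRootSystem]

namespace AlcoveCenter

lemma mem_inversionSet_iff (c : AlcoveCenter b) (w : P.affineWeylGroup) (a : ι × ℤ) :
    a ∈ inversionSet b w ↔ 0 < P.affineRootFun a c.point ∧
      P.affineRootFun a ((w : N ≃ᵃ[ℝ] N) c.point) < 0 := by
  have key : ∀ d, P.MapsAffineRoot w⁻¹ a d →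
      P.affineRootFun d c.point = P.affineRootFun a ((w : N ≃ᵃ[ℝ] N) c.point) := fun d hd => by
    have := hd ((w : N ≃ᵃ[ℝ] N) c.point)
    rwa [coe_inv_apply_coe_apply] at this
  simp only [inversionSet, Set.mem_ofPred_eq, c.isPosAffine_iff]
  refine and_congr_right fun _ => ⟨?_, fun h => ?_⟩
  · rintro ⟨d, hd, hd'⟩
    rw [key d hd] at hd'
    exact lt_of_le_of_ne (not_lt.mp hd') (c.affineRootFun_comp_ne_zero w a)
  · obtain ⟨d, hd, -⟩ := exists_mapsAffineRoot w⁻¹ a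
    exact ⟨d, hd, by rw [key d hd]; exact not_lt.mpr h.le⟩

lemma finite_inversionSet (c : AlcoveCenter b) (w : P.affineWeylGroup) : (inversionSet b w).Finite := by
  let K : ι → Set ℤ := fun i =>
    {m | P.root' i c.point < m ∧ (m : ℝ) < P.root' i ((w : N ≃ᵃ[ℝ] N) c.point)}
  have hK : ∀ i, (K i).Finite := fun i => by
    refine (Set.finite_Icc ⌊P.root' i c.point⌋ ⌈P.root' i ((w : N ≃ᵃ[ℝ] N) c.point)⌉).subset ?_
    rintro m ⟨h1, h2⟩
    exact ⟨by exact_mod_cast (Int.floor_le _).trans h1.le,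
      by exact_mod_cast h2.le.trans (Int.le_ceil _)⟩
  refine (Set.finite_iUnion fun i => (hK i).image fun m => (i, m)).subset ?_
  rintro ⟨i, m⟩ ha
  rw [c.mem_inversionSet_iff] at ha
  simp only [affineRootFun] at ha
  exact Set.mem_iUnion.mpr ⟨i, m, ⟨by linarith [ha.1], by linarith [ha.2]⟩, rfl⟩

lemma inversionSet_one (c : AlcoveCenter b) : inversionSet b (1 : P.affineWeylGroup) = ∅ := by
  ext a
  rw [c.mem_inversionSet_iff]
  simp only [Set.mem_empty_iff_false, iff_false, not_and, not_lt]
  exact fun h => h.le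

variable [P.IsReduced]

/-- The alcoves of w and of w s_d are separated only by the hyperplane of w(d), because s_d changes
the sign of ±d alone. -/
lemma inversionSet_mul_simple_of_pos (c : AlcoveCenter b) {d e : ι × ℤ} (hd : d ∈ c.simpleRoots)
    {w : P.affineWeylGroup} (he : P.MapsAffineRoot w d e) (hpos : 0 < P.affineRootFun e c.point) :
    inversionSet b (w * P.affineReflection d.1 d.2) = insert e (inversionSet b w) ∧
      e ∉ inversionSet b w := by
  have he0 : P.affineRootFun e ((w : N ≃ᵃ[ℝ] N) c.point) = P.affineRootFun d c.point := he _
  have hd0 := c.simpleRoot_pos hd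
  constructor
  · ext a
    rw [Set.mem_insert_iff, c.mem_inversionSet_iff, c.mem_inversionSet_iff]
    obtain ⟨f, hf, -⟩ := exists_mapsAffineRoot w⁻¹ a
    have hf' : ∀ v, P.affineRootFun a ((w : N ≃ᵃ[ℝ] N) v) = P.affineRootFun f v := fun v => by
      rw [← hf, coe_inv_apply_coe_apply]
    rw [coe_mul_apply, hf', hf']
    by_cases hfd : f = d
    · subst hfd
      have hae : a = e := affineRootFun_injective fun v => by
        have h1 := hf' (((w⁻¹ : P.affineWeylGroup) : N ≃ᵃ[ℝ] N) v)
        have h2 := he (((w⁻¹ : P.affineWeylGroup) : N ≃ᵃ[ℝ] N) v)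
        rw [coe_apply_coe_inv_apply] at h1 h2
        rw [h1, h2]
      subst hae
      rw [affineRootFun_affineReflection_self]
      simp [hpos, hd0]
    · have hae : a ≠ e := by
        rintro rfl
        exact hfd (affineRootFun_injective fun v => by rw [← hf', he])
      simp only [hae, false_or]
      refine and_congr_right fun ha => ⟨fun h => ?_, fun h => ?_⟩
      · by_contra! hc
        have h1 := lt_of_le_of_ne hc (c.affineRootFun_ne_zero f).symm
        linarith [c.affineReflection_pos hd h1 hfd]
      · have hnd : P.affineNeg f ≠ d := by
          rintro rfl
          have : P.affineRootFun e c.point = - P.affineRootFun a c.point := by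
            have h2 := he (((w⁻¹ : P.affineWeylGroup) : N ≃ᵃ[ℝ] N) c.point)
            have h1 := hf' (((w⁻¹ : P.affineWeylGroup) : N ≃ᵃ[ℝ] N) c.point)
            rw [coe_apply_coe_inv_apply] at h1 h2
            rw [h2, affineRootFun_affineNeg, h1]
          linarith
        have := c.affineReflection_pos hd (a := P.affineNeg f)
          (by rw [affineRootFun_affineNeg]; linarith) hnd
        rw [affineRootFun_affineNeg] at this
        linarith
  · rw [c.mem_inversionSet_iff, he0]
    exact fun h => absurd h.2 hd0.le.not_gt

lemma ncard_inversionSet_mul_simple_of_pos (c : AlcoveCenter b) {d e : ι × ℤ} (hd : d ∈ c.simpleRoots)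
    {w : P.affineWeylGroup} (he : P.MapsAffineRoot w d e) (hpos : 0 < P.affineRootFun e c.point) :
    (inversionSet b (w * P.affineReflection d.1 d.2)).ncard = (inversionSet b w).ncard + 1 := by
  obtain ⟨h1, h2⟩ := c.inversionSet_mul_simple_of_pos hd he hpos
  rw [h1, Set.ncard_insert_of_notMem h2 (c.finite_inversionSet w)]

lemma ncard_inversionSet_mul_simple_of_neg (c : AlcoveCenter b) {d e : ι × ℤ} (hd : d ∈ c.simpleRoots)
    {w : P.affineWeylGroup} (he : P.MapsAffineRoot w d e) (hneg : P.affineRootFun e c.point < 0) :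
    (inversionSet b (w * P.affineReflection d.1 d.2)).ncard + 1 = (inversionSet b w).ncard := by
  have he' : P.MapsAffineRoot (w * P.affineReflection d.1 d.2) d (P.affineNeg e) := fun v => by
    rw [coe_mul_apply, affineRootFun_affineNeg, he, affineRootFun_affineReflection_self, neg_neg]
  have := c.ncard_inversionSet_mul_simple_of_pos hd he'
    (by rw [affineRootFun_affineNeg]; linarith)
  rw [mul_assoc, affineReflection_mul_self, mul_one] at this
  exact this.symm

variable [P.IsIrreducible]

lemma mem_simpleAffineReflections_iff (c : AlcoveCenter b) {s : P.affineWeylGroup} :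
    s ∈ simpleAffineReflections b ↔
      ∃ d ∈ c.simpleRoots, s = P.affineReflection d.1 d.2 := by
  have hneg : ∀ i, P.affineReflection i 0 = P.affineReflection (P.reflectionPerm i i) 0 :=
    fun i => by
      have := affineReflection_affineNeg (P := P) (i, 0)
      simpa [affineNeg] using this.symm
  constructor
  · rintro (⟨i, hi, rfl⟩ | ⟨i, hi, rfl⟩)
    · exact ⟨_, Or.inl ⟨i, hi, rfl⟩, hneg i⟩
    · exact ⟨_, Or.inr rfl, by rw [hi.eq c.isHighestRoot]⟩
  · rintro ⟨d, ⟨i, hi, rfl⟩ | rfl, rfl⟩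
    · exact Or.inl ⟨i, hi, (hneg i).symm⟩
    · exact Or.inr ⟨_, c.isHighestRoot, rfl⟩

/-- The exchange condition. Applying the letters to d from the right, some letter t turns a positive
root negative; that root is the simple root of t, so t is a conjugate of s_d and can be deleted. -/
lemma exists_shorter_word (c : AlcoveCenter b) {d e : ι × ℤ} (hd : d ∈ c.simpleRoots) (l : List P.affineWeylGroup)
    (hl : ∀ s ∈ l, s ∈ simpleAffineReflections b) (he : P.MapsAffineRoot l.prod d e)
    (hneg : P.affineRootFun e c.point < 0) :
    ∃ l' : List P.affineWeylGroup, l'.length + 1 = l.length ∧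
      (∀ s ∈ l', s ∈ simpleAffineReflections b) ∧
      l'.prod = l.prod * P.affineReflection d.1 d.2 := by
  induction l generalizing e with
  | nil =>
    have : P.affineRootFun e c.point = P.affineRootFun d c.point := he _
    linarith [c.simpleRoot_pos hd]
  | cons t l ih =>
    obtain ⟨f, hf, hf'⟩ := exists_mapsAffineRoot l.prod d
    obtain ⟨a, ha, rfl⟩ := c.mem_simpleAffineReflections_iff.mp (hl t (by simp))
    rcases lt_or_gt_of_ne (c.affineRootFun_ne_zero f) with h | h
    · obtain ⟨l', h1, h2, h3⟩ := ih (fun s hs => hl s (by simp [hs])) hf h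
      refine ⟨P.affineReflection a.1 a.2 :: l', by simp [h1], ?_, ?_⟩
      · intro s hs
        rcases List.mem_cons.mp hs with rfl | hs
        · exact hl _ (by simp)
        · exact h2 s hs
      · rw [List.prod_cons, List.prod_cons, h3, mul_assoc]
    · have hfa : f = a := by
        by_contra hfa
        have h1 := c.affineReflection_pos ha h hfa
        have h2 := he (((l.prod⁻¹ : P.affineWeylGroup) : N ≃ᵃ[ℝ] N)
          ((P.affineReflection a.1 a.2 : N ≃ᵃ[ℝ] N) c.point))
        have h3 := hf (((l.prod⁻¹ : P.affineWeylGroup) : N ≃ᵃ[ℝ] N)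
          ((P.affineReflection a.1 a.2 : N ≃ᵃ[ℝ] N) c.point))
        rw [List.prod_cons, coe_mul_apply, coe_apply_coe_inv_apply, ← coe_mul_apply,
          affineReflection_mul_self] at h2
        rw [coe_apply_coe_inv_apply] at h3
        rw [h3, ← h2] at h1
        exact absurd hneg h1.le.not_gt
      subst hfa
      refine ⟨l, rfl, fun s hs => hl s (by simp [hs]), ?_⟩
      rw [List.prod_cons, ← hf', inv_mul_cancel_right, mul_assoc, affineReflection_mul_self,
        mul_one]

/-- This expands a positive affine root in the simple ones: m copies of θ + δ plus a sum of negated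
simple roots at level 0. -/
lemma sub_mem_closure_of_pos (c : AlcoveCenter b) {a : ι × ℤ}
    (ha : 0 < P.affineRootFun a c.point) :
    0 ≤ a.2 ∧ a.2 • P.root c.θ - P.root a.1 ∈ AddSubmonoid.closure (P.root '' b.support) := by
  rw [← c.isPosAffine_iff] at ha
  have hθ := (isPos_iff_mem_closure b).mp c.isHighestRoot.isPos
  have key : 0 < a.2 → a.2 • P.root c.θ - P.root a.1 ∈
      AddSubmonoid.closure (P.root '' b.support) := fun h => by
    obtain ⟨n, hn⟩ := Int.eq_ofNat_of_zero_le (show 0 ≤ a.2 - 1 by omega)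
    have h1 : a.2 • P.root c.θ - P.root a.1 = n • P.root c.θ + (P.root c.θ - P.root a.1) := by
      rw [show a.2 = n + 1 by omega, add_smul, one_smul, natCast_zsmul]
      abel
    rw [h1]
    exact add_mem (nsmul_mem hθ n) (c.isHighestRoot a.1)
  rcases ha with ⟨h1, h2⟩ | ⟨h1, h2⟩
  · exact ⟨h2.le, key h2⟩
  · refine ⟨h2, ?_⟩
    rcases h2.eq_or_lt with h3 | h3
    · rw [← h3, zero_smul, zero_sub]
      exact (b.root_mem_or_neg_mem a.1).resolve_left (by rwa [← isPos_iff_mem_closure])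
    · exact key h3

/-- The finite part has positive norm and is a non-negative combination of the finite parts of
simple affine roots, so it pairs positively with one of them. -/
lemma exists_simpleRoot_pairingIn_pos (c : AlcoveCenter b) {a : ι × ℤ}
    (ha : 0 < P.affineRootFun a c.point) : ∃ d ∈ c.simpleRoots, 0 < P.pairingIn ℤ a.1 d.1 := by
  obtain ⟨h0, h1⟩ := c.sub_mem_closure_of_pos ha
  have hpos := rootForm_self_pos (P := P) (neg_ne_zero.mpr (P.ne_zero a.1))
  by_cases hθ : 0 < P.RootForm (P.root a.1) (P.root c.θ)
  · exact ⟨_, Or.inr rfl, (zero_lt_pairingIn_iff_rootForm _ _).mpr hθ⟩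
  · obtain ⟨m, hm, hm'⟩ := AddSubmonoid.exists_multiset_of_mem_closure h1
    have h2 : 0 < P.RootForm (-P.root a.1) m.sum := by
      have h3 : -P.root a.1 = m.sum - a.2 • P.root c.θ := by rw [hm']; abel
      have h4 : P.RootForm (-P.root a.1) m.sum = P.RootForm (-P.root a.1) (-P.root a.1) -
          a.2 * P.RootForm (P.root a.1) (P.root c.θ) := by
        conv_rhs => enter [1, 2]; rw [h3]
        simp
      have h5 : (0 : ℝ) ≤ a.2 := by exact_mod_cast h0
      nlinarith [not_lt.mp hθ]
    obtain ⟨y, hy, hy'⟩ := exists_rootForm_pos_of_multiset_sum m _ h2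
    obtain ⟨i, hi, rfl⟩ := hm y hy
    refine ⟨_, Or.inl ⟨i, hi, rfl⟩, (zero_lt_pairingIn_iff_rootForm _ _).mpr ?_⟩
    simpa using hy'

/-- Reflecting a non-simple positive affine root in a simple one that pairs positively with it
lowers the affine height and keeps it positive; conjugation then reduces to smaller height. -/
lemma affineReflection_mem_closure (c : AlcoveCenter b) (a : ι × ℤ) :
    P.affineReflection a.1 a.2 ∈ Subgroup.closure (simpleAffineReflections b) := by
  have key : ∀ n : ℕ, ∀ a : ι × ℤ, 0 < P.affineRootFun a c.point →
      (c.affineHeight a).toNat = n →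
      P.affineReflection a.1 a.2 ∈ Subgroup.closure (simpleAffineReflections b) := by
    intro n
    induction n using Nat.strong_induction_on with
    | _ n ih =>
      intro a ha hn
      obtain ⟨d, hd, hp⟩ := c.exists_simpleRoot_pairingIn_pos ha
      have hdS : P.affineReflection d.1 d.2 ∈ Subgroup.closure (simpleAffineReflections b) :=
        Subgroup.subset_closure (c.mem_simpleAffineReflections_iff.mpr ⟨d, hd, rfl⟩)
      by_cases had : a = d
      · rw [had]; exact hdS
      obtain ⟨e, he, he'⟩ := exists_mapsAffineRoot (P.affineReflection d.1 d.2) a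
      have he1 : P.affineRootFun e c.point =
          P.affineRootFun a ((P.affineReflection d.1 d.2 : N ≃ᵃ[ℝ] N) c.point) := by
        rw [← he, ← coe_mul_apply, affineReflection_mul_self]
        rfl
      have hepos : 0 < P.affineRootFun e c.point := by
        rw [he1]
        exact c.affineReflection_pos hd ha had
      have hh : c.affineHeight e = c.affineHeight a - P.pairingIn ℤ a.1 d.1 := by
        have h1 := c.affineHeight_eq e
        have h2 := c.affineHeight_eq d
        have hpr : (P.pairingIn ℤ a.1 d.1 : ℝ) = P.pairing a.1 d.1 := P.algebraMap_pairingIn ℤ _ _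
        have h3 : P.affineRootFun e c.point = P.affineRootFun a c.point -
            P.affineRootFun d c.point * P.pairingIn ℤ a.1 d.1 := by
          rw [he1, coe_affineReflection_apply, hpr]
          simp only [affineRootFun, map_add, map_smul, smul_eq_mul, root'_coroot_eq_pairing]
          ring
        rw [h3, mul_sub, ← c.affineHeight_eq, ← mul_assoc, ← h2, c.affineHeight_simpleRoot hd] at h1
        rw [Int.cast_one, one_mul] at h1
        exact_mod_cast h1
      have hmem := ih _ (by have := (c.affineHeight_pos_iff e).mpr hepos; omega) e hepos rfl
      have : P.affineReflection a.1 a.2 = P.affineReflection d.1 d.2 *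
          P.affineReflection e.1 e.2 * P.affineReflection d.1 d.2 := by
        rw [← he', affineReflection_inv]
        simp only [mul_assoc, affineReflection_mul_self, mul_one]
        rw [← mul_assoc, affineReflection_mul_self, one_mul]
      rw [this]
      exact mul_mem (mul_mem hdS hmem) hdS
  rcases lt_or_gt_of_ne (c.affineRootFun_ne_zero a) with h | h
  · rw [← affineReflection_affineNeg]
    exact key _ _ (by rw [affineRootFun_affineNeg]; linarith) rfl
  · exact key _ _ h rfl

lemma closure_simpleAffineReflections (c : AlcoveCenter b) :
    Subgroup.closure (simpleAffineReflections b) = (⊤ : Subgroup P.affineWeylGroup) := by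
  rw [eq_top_iff]
  rintro w -
  have hlin : ∀ g ∈ P.weylGroupOnCoweights,
      ∃ u ∈ Subgroup.closure (simpleAffineReflections b),
        ∀ v, (u : N ≃ᵃ[ℝ] N) v = g v := by
    have gen : ∀ i, ∃ u ∈ Subgroup.closure (simpleAffineReflections b),
        ∀ v, (u : N ≃ᵃ[ℝ] N) v = P.coreflection i v := fun i =>
      ⟨_, c.affineReflection_mem_closure (i, 0), fun v => by
        simp [affineReflection_apply, coreflection_apply]⟩
    intro g hg
    induction hg using Subgroup.closure_induction'' with
    | one => exact ⟨1, one_mem _, fun v => rfl⟩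
    | mem g hg => obtain ⟨k, rfl⟩ := hg; exact gen k
    | inv_mem g hg => obtain ⟨k, rfl⟩ := hg; rw [coreflection_inv]; exact gen k
    | mul g h _ _ hg hh =>
      obtain ⟨x, hx, hx'⟩ := hg
      obtain ⟨y, hy, hy'⟩ := hh
      exact ⟨x * y, mul_mem hx hy, fun v => by rw [coe_mul_apply, hx', hy']; rfl⟩
  have htrans : ∀ x ∈ P.corootSpan ℤ, ∃ u ∈ Subgroup.closure (simpleAffineReflections b),
      ∀ v, (u : N ≃ᵃ[ℝ] N) v = v + x := by
    have hadd : ∀ x y : N,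
        (∃ u ∈ Subgroup.closure (simpleAffineReflections b), ∀ v, (u : N ≃ᵃ[ℝ] N) v = v + x) →
        (∃ u ∈ Subgroup.closure (simpleAffineReflections b), ∀ v, (u : N ≃ᵃ[ℝ] N) v = v + y) →
        ∃ u ∈ Subgroup.closure (simpleAffineReflections b),
          ∀ v, (u : N ≃ᵃ[ℝ] N) v = v + (x + y) := by
      rintro x y ⟨u, hu, hu'⟩ ⟨t, ht, ht'⟩
      exact ⟨u * t, mul_mem hu ht, fun v => by rw [coe_mul_apply, hu', ht']; abel⟩
    have hneg : ∀ x : N,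
        (∃ u ∈ Subgroup.closure (simpleAffineReflections b), ∀ v, (u : N ≃ᵃ[ℝ] N) v = v + x) →
        ∃ u ∈ Subgroup.closure (simpleAffineReflections b), ∀ v, (u : N ≃ᵃ[ℝ] N) v = v + -x := by
      rintro x ⟨u, hu, hu'⟩
      refine ⟨u⁻¹, inv_mem hu, fun v => (u : N ≃ᵃ[ℝ] N).injective ?_⟩
      rw [coe_apply_coe_inv_apply, hu']
      abel
    intro x hx
    induction hx using Submodule.span_induction with
    | mem x hx =>
      obtain ⟨i, rfl⟩ := hx
      -- Reflecting in the parallel hyperplanes at levels 0 and then 1 is translation by the coroot.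
      refine ⟨_, mul_mem (c.affineReflection_mem_closure (i, 1))
        (c.affineReflection_mem_closure (i, 0)), fun v => ?_⟩
      rw [coe_mul_apply, affineReflection_apply, affineReflection_apply]
      simp only [map_sub, map_smul, root'_coroot_eq_pairing, pairing_same]
      module
    | zero => exact ⟨1, one_mem _, fun v => (add_zero v).symm⟩
    | add x y _ _ hx hy => exact hadd x y hx hy
    | smul n x _ hx =>
      induction n using Int.induction_on with
      | zero => exact ⟨1, one_mem _, fun v => by rw [zero_smul, add_zero]; rfl⟩
      | succ n ih => rw [add_smul, one_smul]; exact hadd _ _ ih hx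
      | pred n ih => rw [sub_smul, one_smul, sub_eq_add_neg]; exact hadd _ _ ih (hneg _ hx)
  obtain ⟨u, hu, hu'⟩ := hlin _ w.2.1
  obtain ⟨t, ht, ht'⟩ := htrans _ w.2.2
  have : w = t * u := affineWeylGroup_ext fun v => by
    rw [coe_mul_apply, ht', hu']
    have := coe_apply_add w 0 v
    rwa [zero_add] at this
  rw [this]
  exact mul_mem ht hu

lemma exists_reduced_word (c : AlcoveCenter b) (w : P.affineWeylGroup) :
    ∃ l : List P.affineWeylGroup, l.length = (inversionSet b w).ncard ∧
      (∀ s ∈ l, s ∈ simpleAffineReflections b) ∧ l.prod = w := by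
  have hw : w ∈ Subgroup.closure (simpleAffineReflections b) := by
    rw [c.closure_simpleAffineReflections]; trivial
  have step : ∀ x : P.affineWeylGroup, ∀ s ∈ simpleAffineReflections b,
      (∃ l : List P.affineWeylGroup, l.length = (inversionSet b x).ncard ∧
        (∀ s ∈ l, s ∈ simpleAffineReflections b) ∧ l.prod = x) →
      ∃ l : List P.affineWeylGroup, l.length = (inversionSet b (x * s)).ncard ∧
        (∀ s ∈ l, s ∈ simpleAffineReflections b) ∧ l.prod = x * s := by
    rintro x s hs ⟨l, h1, h2, rfl⟩
    obtain ⟨d, hd, rfl⟩ := c.mem_simpleAffineReflections_iff.mp hs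
    obtain ⟨e, he, -⟩ := exists_mapsAffineRoot l.prod d
    rcases lt_or_gt_of_ne (c.affineRootFun_ne_zero e) with h | h
    · obtain ⟨l', h3, h4, h5⟩ := c.exists_shorter_word hd l h2 he h
      have := c.ncard_inversionSet_mul_simple_of_neg hd he h
      exact ⟨l', by omega, h4, h5⟩
    · refine ⟨l ++ [P.affineReflection d.1 d.2], ?_, ?_, by simp⟩
      · rw [c.ncard_inversionSet_mul_simple_of_pos hd he h, ← h1]; simp
      · intro t ht
        rcases List.mem_append.mp ht with ht | ht
        · exact h2 t ht
        · rwa [List.mem_singleton.mp ht]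
  induction hw using Subgroup.closure_induction_right with
  | one => exact ⟨[], by simp [c.inversionSet_one], by simp, rfl⟩
  | mul_right x _ s hs ih => exact step x _ hs ih
  | mul_inv_cancel x _ s hs ih =>
    have : s⁻¹ = s := by
      obtain ⟨d, -, rfl⟩ := c.mem_simpleAffineReflections_iff.mp hs
      exact affineReflection_inv d
    rw [this]
    exact step x _ hs ih

lemma ncard_inversionSet_prod_le (c : AlcoveCenter b) (l : List P.affineWeylGroup)
    (hl : ∀ s ∈ l, s ∈ simpleAffineReflections b) :
    (inversionSet b l.prod).ncard ≤ l.length := by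
  induction l using List.reverseRecOn with
  | nil => simp [c.inversionSet_one]
  | append_singleton l s ih =>
    have h1 := ih fun t ht => hl t (by simp [ht])
    obtain ⟨d, hd, rfl⟩ := c.mem_simpleAffineReflections_iff.mp (hl s (by simp))
    obtain ⟨e, he, -⟩ := exists_mapsAffineRoot l.prod d
    rw [List.prod_append, List.prod_singleton, List.length_append, List.length_singleton]
    rcases lt_or_gt_of_ne (c.affineRootFun_ne_zero e) with h | h
    · have := c.ncard_inversionSet_mul_simple_of_neg hd he h
      omega
    · have := c.ncard_inversionSet_mul_simple_of_pos hd he h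
      omega

lemma wordLength_eq_ncard_inversionSet (c : AlcoveCenter b) (w : P.affineWeylGroup) :
    wordLength (simpleAffineReflections b) w = (inversionSet b w).ncard := by
  obtain ⟨l, h1, h2, h3⟩ := c.exists_reduced_word w
  refine le_antisymm (Nat.sInf_le ⟨l, h1, h2, h3⟩) (le_csInf ⟨_, l, h1, h2, h3⟩ ?_)
  rintro n ⟨l, rfl, hl, rfl⟩
  exact c.ncard_inversionSet_prod_le l hl

lemma eq_one_of_inversionSet_eq_empty (c : AlcoveCenter b) {w : P.affineWeylGroup} (h : inversionSet b w = ∅) :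
    w = 1 := by
  obtain ⟨l, h1, h2, rfl⟩ := c.exists_reduced_word w
  rw [h, Set.ncard_empty, List.length_eq_zero_iff] at h1
  rw [h1, List.prod_nil]

/-- An inversion of x⁻¹w would be carried by x to an affine root separating the alcoves of x and w;
up to sign it lies in exactly one of the two inversion sets. -/
lemma inversionSet_injective (c : AlcoveCenter b) {x w : P.affineWeylGroup}
    (h : inversionSet b x = inversionSet b w) : x = w := by
  refine inv_mul_eq_one.mp (c.eq_one_of_inversionSet_eq_empty (Set.eq_empty_of_forall_notMem ?_))
  intro a ha
  rw [c.mem_inversionSet_iff] at ha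
  obtain ⟨e, he, -⟩ := exists_mapsAffineRoot x a
  have h1 : P.affineRootFun e ((x : N ≃ᵃ[ℝ] N) c.point) = P.affineRootFun a c.point := he _
  have h2 : P.affineRootFun e ((w : N ≃ᵃ[ℝ] N) c.point) =
      P.affineRootFun a (((x⁻¹ * w : P.affineWeylGroup) : N ≃ᵃ[ℝ] N) c.point) := by
    rw [← he, ← coe_mul_apply, mul_inv_cancel_left]
  rw [← h1, ← h2] at ha
  rcases lt_or_gt_of_ne (c.affineRootFun_ne_zero e) with h0 | h0
  · have h3 : P.affineNeg e ∈ inversionSet b x := by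
      rw [c.mem_inversionSet_iff, affineRootFun_affineNeg, affineRootFun_affineNeg]
      constructor <;> linarith
    rw [h, c.mem_inversionSet_iff, affineRootFun_affineNeg, affineRootFun_affineNeg] at h3
    linarith
  · have h3 : e ∈ inversionSet b w := by
      rw [c.mem_inversionSet_iff]
      exact ⟨h0, ha.2⟩
    rw [← h, c.mem_inversionSet_iff] at h3
    linarith

end AlcoveCenter

end Length

/-! ### Sums of positive roots outside an ideal. -/

section IdealComplement

/-- `x` is a sum of `n` positive roots that do not lie in `I`. -/
def IsSumOutside (b : P.Base) (I : Set ι) (n : ℕ) (x : M) : Prop :=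
  ∃ m : Multiset ι, Multiset.card m = n ∧ (∀ i ∈ m, b.IsPos i ∧ i ∉ I) ∧ x = (m.map P.root).sum

variable {b : P.Base} {I : Set ι}

lemma IsSumOutside.single {i : ι} (hi : b.IsPos i) (hiI : i ∉ I) :
    IsSumOutside b I 1 (P.root i) :=
  ⟨{i}, by simp, by simp [hi, hiI], by simp⟩

lemma IsSumOutside.add {n k : ℕ} {x y : M} (hx : IsSumOutside b I n x)
    (hy : IsSumOutside b I k y) : IsSumOutside b I (n + k) (x + y) := by
  obtain ⟨m, rfl, hm, rfl⟩ := hx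
  obtain ⟨m', rfl, hm', rfl⟩ := hy
  refine ⟨m + m', by simp, fun i hi => ?_, by simp⟩
  exact (Multiset.mem_add.mp hi).elim (hm i) (hm' i)

lemma IsSumOutside.le {n : ℕ} {x : M} (hx : IsSumOutside b I n x) {v : N}
    (hv : ∀ i, b.IsPos i → i ∉ I → P.root' i v ≤ 1) : P.toLinearMap x v ≤ n := by
  obtain ⟨m, rfl, hm, rfl⟩ := hx
  induction m using Multiset.induction with
  | empty => simp
  | cons i m ih =>
    have h1 := ih fun j hj => hm j (by simp [hj])
    have h2 := hv i (hm i (by simp)).1 (hm i (by simp)).2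
    simp only [Multiset.map_cons, Multiset.sum_cons, map_add, LinearMap.add_apply,
      Multiset.card_cons]
    push_cast
    change P.root' i v + _ ≤ _
    linarith

lemma IsSumOutside.height_le [P.IsRootSystem] {n : ℕ} {i : ι}
    (hi : IsSumOutside b I n (P.root i)) : (n : ℤ) ≤ b.height i := by
  obtain ⟨ρ, hρ⟩ := exists_heightPoint b
  have key : ∀ m : Multiset ι, (∀ j ∈ m, b.IsPos j ∧ j ∉ I) →
      (Multiset.card m : ℝ) ≤ P.toLinearMap (m.map P.root).sum ρ := by
    intro m hm
    induction m using Multiset.induction with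
    | empty => simp
    | cons j m ih =>
      have h1 := ih fun k hk => hm k (by simp [hk])
      have h2 : (1 : ℝ) ≤ P.root' j ρ := by
        rw [hρ]; exact_mod_cast b.isPos_iff.mp (hm j (by simp)).1
      simp only [Multiset.map_cons, Multiset.sum_cons, map_add, LinearMap.add_apply,
        Multiset.card_cons]
      push_cast
      change _ ≤ P.root' j ρ + _
      linarith
  obtain ⟨m, rfl, hm, hi⟩ := hi
  have h1 := key m hm
  rw [← hi] at h1
  change _ ≤ P.root' i ρ at h1
  rw [hρ] at h1
  exact_mod_cast h1

lemma height_add_eq_zero {i j : ι} (h : P.root i + P.root j = 0) :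
    b.height i + b.height j = 0 := by
  let := P.indexNeg
  have h1 : i = -j := P.root.injective (by simpa using eq_neg_of_add_eq_zero_left h)
  rw [h1, b.height_reflectionPerm_self]
  ring

variable [Fintype ι] [P.IsCrystallographic] [P.IsRootSystem]

/-- Since α + β has positive norm, some summand γ pairs positively with α or β, say α. If α = γ,
remove it. If α − γ is a positive root, split (α − γ) + β by induction. If γ − α is a positive root,
then α and γ − α are both outside I because γ is; this is where the extra root arises. The sum α + β
need not be a root. -/
lemma IsSumOutside.exists_split (hI : IsRootIdeal b I) {n : ℕ} {i j : ι} (hi : b.IsPos i)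
    (hj : b.IsPos j) (h : IsSumOutside b I n (P.root i + P.root j)) :
    ∃ p q, p + q ≤ n + 1 ∧ IsSumOutside b I p (P.root i) ∧ IsSumOutside b I q (P.root j) := by
  classical
  induction n generalizing i j with
  | zero =>
    obtain ⟨m, hm, -, h⟩ := h
    rw [Multiset.card_eq_zero] at hm
    rw [hm] at h
    have h1 := height_add_eq_zero (b := b) (by simpa using h)
    have h2 := b.isPos_iff.mp hi
    have h3 := b.isPos_iff.mp hj
    omega
  | succ n ih =>
    have aux : ∀ {i j k : ι} (x : M), b.IsPos i → b.IsPos j → b.IsPos k → k ∉ I →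
        IsSumOutside b I n x → P.root i + P.root j = P.root k + x →
        0 < P.RootForm (P.root i) (P.root k) →
        ∃ p q, p + q ≤ n + 1 + 1 ∧ IsSumOutside b I p (P.root i) ∧
          IsSumOutside b I q (P.root j) := by
      intro i j k x hi hj hk hkI hx hsum hik
      by_cases hne : i = k
      · subst hne
        refine ⟨1, n, by omega, .single hi hkI, ?_⟩
        rwa [add_left_cancel hsum]
      · obtain ⟨l, hl⟩ := root_sub_root_mem_of_rootForm_pos hik hne
        let := P.indexNeg
        rcases Base.IsPos.or_neg b l with hlp | hlp
        · obtain ⟨p, q, h1, h2, h3⟩ := ih hlp hj (by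
            rw [show P.root l + P.root j = x by
              rw [hl, sub_add_eq_add_sub, hsum, add_sub_cancel_left]]
            exact hx)
          refine ⟨p + 1, q, by omega, ?_, h3⟩
          rw [show P.root i = P.root l + P.root k by rw [hl]; abel]
          exact h2.add (.single hk hkI)
        · have hl' : P.root (-l) = P.root k - P.root i := by
            have : P.root (-l) = -P.root l := by simp
            rw [this, hl, neg_sub]
          have hiI : i ∉ I := fun h => hkI (hI.add_mem i h (-l) hlp k hk (by rw [hl']; abel))
          have hlI : -l ∉ I := fun h => hkI (hI.add_mem (-l) h i hi k hk (by rw [hl']; abel))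
          refine ⟨1, 1 + n, by omega, .single hi hiI, ?_⟩
          rw [show P.root j = P.root (-l) + x by
            rw [hl', sub_add_eq_add_sub, ← hsum, add_sub_cancel_left]]
          exact (IsSumOutside.single hlp hlI).add hx
    have hne : P.root i + P.root j ≠ 0 := fun h0 => by
      have h1 := height_add_eq_zero (b := b) h0
      have h2 := b.isPos_iff.mp hi
      have h3 := b.isPos_iff.mp hj
      omega
    obtain ⟨m, hm, hmI, hsum⟩ := h
    have hpos := rootForm_self_pos (P := P) hne
    -- Only the second argument of the form is expanded, so that a summand pairing positively with α
    -- + β can be extracted.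
    conv at hpos => enter [2, 2]; rw [hsum]
    obtain ⟨y, hy, hyk⟩ := exists_rootForm_pos_of_multiset_sum _ _ hpos
    obtain ⟨k, hk, rfl⟩ := Multiset.mem_map.mp hy
    clear hpos
    obtain ⟨m, rfl⟩ := Multiset.exists_cons_of_mem hk
    rw [Multiset.map_cons, Multiset.sum_cons] at hsum
    have hx : IsSumOutside b I n (m.map P.root).sum :=
      ⟨m, by simpa using hm, fun l hl => hmI l (by simp [hl]), rfl⟩
    obtain ⟨hkp, hkI⟩ := hmI k hk
    rw [map_add, LinearMap.add_apply] at hyk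
    by_cases hik : 0 < P.RootForm (P.root i) (P.root k)
    · exact aux _ hi hj hkp hkI hx hsum hik
    · obtain ⟨p, q, h1, h2, h3⟩ := aux _ hj hi hkp hkI hx (by rw [add_comm, hsum])
        (by linarith)
      exact ⟨q, p, by omega, h3, h2⟩

end IdealComplement

/-! ### Sign types and local maximality. -/

section SignType

variable {b : P.Base} {I : Set ι}
variable [Fintype ι] [P.IsCrystallographic] [P.IsRootSystem]

lemma eq_add_of_affineRootFun_eq_add {a d e : ι × ℤ}
    (h : ∀ v, P.affineRootFun a v = P.affineRootFun d v + P.affineRootFun e v) :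
    a.2 = d.2 + e.2 ∧ P.root a.1 = P.root d.1 + P.root e.1 := by
  have h0 : (a.2 : ℝ) = d.2 + e.2 := by simpa [affineRootFun] using h 0
  refine ⟨by exact_mod_cast h0, ?_⟩
  apply P.toLinearMap.toPerfPair.injective
  ext v
  have := h v
  simp only [affineRootFun, h0] at this
  rw [map_add, LinearMap.add_apply]
  change P.root' a.1 v = P.root' d.1 v + P.root' e.1 v
  linarith

namespace AlcoveCenter

/-- Otherwise −α at level 0 would be an inversion, putting a negative root in the support. -/
lemma root'_pos_of_mem_signType (c : AlcoveCenter b) (hI : IsRootIdeal b I) {w : P.affineWeylGroup}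
    (hw : w ∈ signType b I) {i : ι} (hi : b.IsPos i) :
    0 < P.root' i ((w : N ≃ᵃ[ℝ] N) c.point) := by
  let := P.indexNeg
  have hneg : ∀ v, P.affineRootFun (-i, 0) v = P.root' i v := fun v => by
    change ((0 : ℤ) : ℝ) - P.root' (P.reflectionPerm i i) v = P.root' i v
    rw [root'_reflectionPerm_self]
    simp
  have hnp : ¬ b.IsPos (-i) := by rw [Base.IsPos.neg_iff_not]; simpa using hi
  by_contra! hc
  have h0 := c.affineRootFun_comp_ne_zero w (-i, 0)
  rw [hneg] at h0
  have hmem : (-i, (0 : ℤ)) ∈ inversionSet b w := by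
    rw [c.mem_inversionSet_iff, ← c.isPosAffine_iff, hneg]
    exact ⟨Or.inr ⟨hnp, le_rfl⟩, lt_of_le_of_ne hc h0⟩
  have : -i ∈ affineSupp b w := ⟨0, hmem⟩
  rw [show affineSupp b w = I from hw] at this
  exact hnp (hI.isPos _ this)

lemma mem_iff_of_mem_signType (c : AlcoveCenter b) {w : P.affineWeylGroup}
    (hw : w ∈ signType b I) {i : ι} (hi : b.IsPos i) :
    i ∈ I ↔ 1 < P.root' i ((w : N ≃ᵃ[ℝ] N) c.point) := by
  rw [← show affineSupp b w = I from hw]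
  constructor
  · rintro ⟨m, hm⟩
    rw [c.mem_inversionSet_iff, ← c.isPosAffine_iff] at hm
    rcases hm with ⟨⟨-, h1⟩ | ⟨h1, -⟩, h2⟩
    · have h3 : (1 : ℝ) ≤ m := by exact_mod_cast h1
      simp only [affineRootFun] at h2
      linarith
    · exact absurd hi h1
  · intro h
    refine ⟨1, (c.mem_inversionSet_iff _ _).mpr ⟨?_, ?_⟩⟩
    · rw [← c.isPosAffine_iff]
      exact Or.inl ⟨hi, one_pos⟩
    · simp only [affineRootFun]
      push_cast
      linarith

variable [P.IsReduced] [P.IsIrreducible]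

/-- If δ cannot be subtracted, the level is minimal: 1 over a positive root, 0 over a negative one.
A positive root other than θ can be raised by a simple root, and a non-simple positive root can be
lowered by one; either splits off a simple affine root. -/
lemma exists_decomposition (c : AlcoveCenter b) {d : ι × ℤ} (hd : 0 < P.affineRootFun d c.point)
    (hds : d ∉ c.simpleRoots) :
    0 < P.affineRootFun (d.1, d.2 - 1) c.point ∨
      ∃ e f, 0 < P.affineRootFun e c.point ∧ 0 < P.affineRootFun f c.point ∧
        ∀ v, P.affineRootFun d v = P.affineRootFun e v + P.affineRootFun f v := by
  simp only [← c.isPosAffine_iff] at hd ⊢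
  obtain ⟨i, m⟩ := d
  rw [or_iff_not_imp_left]
  intro hn
  simp only [IsPosAffine] at hd hn
  have hsimple : ∀ j ∈ b.support, IsPosAffine b (P.reflectionPerm j j, 0) := fun j hj => by
    rw [c.isPosAffine_iff]
    exact c.simpleRoot_pos (Or.inl ⟨j, hj, rfl⟩)
  by_cases hi : b.IsPos i
  · have hm : m = 1 := by
      simp only [hi, true_and, not_true, false_and, or_false] at hd hn
      omega
    subst hm
    have hi' : ¬ IsTopRoot b i := fun h =>
      hds (Or.inr (by rw [h.eq c.isHighestRoot.isTopRoot]))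
    simp only [IsTopRoot, hi, true_and, not_forall, not_not] at hi'
    obtain ⟨j, hj, k, hk⟩ := hi'
    refine ⟨(k, 1), (P.reflectionPerm j j, 0),
      Or.inl ⟨hi.add (b.isPos_of_mem_support hj) hk, one_pos⟩, hsimple j hj, fun v => ?_⟩
    simp only [affineRootFun, root'_reflectionPerm_self]
    rw [root', root', root', hk, map_add, LinearMap.add_apply]
    push_cast
    ring
  · have hm : m = 0 := by
      simp only [hi, false_and, not_false_eq_true, true_and, false_or] at hd hn
      omega
    subst hm
    let := P.indexNeg
    have hni : b.IsPos (-i) := by rwa [Base.IsPos.neg_iff_not]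
    obtain ⟨j, hj, h1, -⟩ :=
      exists_sub_simple_mem_closure b ((isPos_iff_mem_closure b).mp hni) (P.ne_zero _)
    have hne : -i ≠ j := by
      rintro rfl
      refine hds (Or.inl ⟨-i, hj, Prod.ext ?_ rfl⟩)
      exact (neg_neg i).symm
    obtain ⟨k, hk⟩ := root_sub_root_mem_of_rootForm_pos h1 hne
    have hkp : b.IsPos k := hni.sub hj hk
    refine ⟨(-k, 0), (P.reflectionPerm j j, 0), Or.inr ⟨?_, le_rfl⟩, hsimple j hj, fun v => ?_⟩
    · rw [Base.IsPos.neg_iff_not]; simpa using hkp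
    · change ((0 : ℤ) : ℝ) - P.root' i v = ((0 : ℤ) : ℝ) - P.root' (P.reflectionPerm k k) v +
        (((0 : ℤ) : ℝ) - P.root' (P.reflectionPerm j j) v)
      rw [root'_reflectionPerm_self, root'_reflectionPerm_self]
      have h2 : P.root i = -P.root k - P.root j := by
        have : P.root (-i) = -P.root i := by simp
        rw [hk, ← neg_eq_iff_eq_neg.mpr this]
        abel
      rw [root', root', root', h2, map_sub, map_neg]
      simp only [LinearMap.sub_apply, LinearMap.neg_apply]
      push_cast
      ring

/-- Multiplying w by the simple reflection adds just this affine root to N(w). Were its finite part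
in I, the support would not change, against local maximality. -/
lemma notMem_of_mapsAffineRoot_simple (c : AlcoveCenter b) {w : P.affineWeylGroup}
    (hw : w ∈ signType b I)
    (hmax : ∀ s ∈ simpleAffineReflections b,
      BruhatLT (simpleAffineReflections b) w (w * s) → w * s ∉ signType b I)
    {d a : ι × ℤ} (hd : d ∈ c.simpleRoots) (ha : P.MapsAffineRoot w d a)
    (hpos : 0 < P.affineRootFun a c.point) : a.1 ∉ I := by
  intro haI
  have hs := c.mem_simpleAffineReflections_iff.mpr ⟨d, hd, rfl⟩
  refine hmax _ hs (Relation.TransGen.single ⟨_, ⟨1, _, hs, ?_⟩, rfl, ?_⟩) ?_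
  · simp
  · rw [c.wordLength_eq_ncard_inversionSet, c.wordLength_eq_ncard_inversionSet,
      c.ncard_inversionSet_mul_simple_of_pos hd ha hpos]
    exact Nat.lt_succ_self _
  · change affineSupp b _ = I
    have hw' : affineSupp b w = I := hw
    ext i
    simp only [affineSupp, (c.inversionSet_mul_simple_of_pos hd ha hpos).1, Set.mem_insert_iff,
      Set.mem_ofPred_eq]
    constructor
    · rintro ⟨m, h | h⟩
      · rw [← h] at haI; exact haI
      · rw [← hw']; exact ⟨m, h⟩
    · intro h
      rw [← hw'] at h
      exact h.imp fun m hm => Or.inr hm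

lemma exists_isSumOutside (c : AlcoveCenter b) (hI : IsRootIdeal b I) {w : P.affineWeylGroup}
    (hw : w ∈ signType b I)
    (hmax : ∀ s ∈ simpleAffineReflections b,
      BruhatLT (simpleAffineReflections b) w (w * s) → w * s ∉ signType b I)
    {a : ι × ℤ} (ha : b.IsPos a.1)
    (hpos : 0 < P.affineRootFun a ((w : N ≃ᵃ[ℝ] N) c.point)) :
    ∃ k : ℕ, (k : ℤ) ≤ a.2 ∧ IsSumOutside b I k (P.root a.1) := by
  obtain ⟨d, hd, -⟩ := exists_mapsAffineRoot w⁻¹ a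
  have hda : P.MapsAffineRoot w d a := fun v => by
    rw [← hd, coe_inv_apply_coe_apply]
  have hd0 : 0 < P.affineRootFun d c.point := by rwa [← hda]
  clear hd hpos
  generalize hn : (c.affineHeight d).toNat = n
  induction n using Nat.strong_induction_on generalizing a d with
  | _ n ih =>
    have hdh := (c.affineHeight_pos_iff d).mpr hd0
    have hau : P.root' a.1 ((w : N ≃ᵃ[ℝ] N) c.point) < a.2 := by
      have := hda c.point
      simp only [affineRootFun] at this hd0
      linarith
    have ha2 : 1 ≤ a.2 := by
      have : (0 : ℝ) < a.2 := (c.root'_pos_of_mem_signType hI hw ha).trans hau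
      exact_mod_cast this
    by_cases hds : d ∈ c.simpleRoots
    · have hap : 0 < P.affineRootFun a c.point := by
        rw [← c.isPosAffine_iff]
        exact Or.inl ⟨ha, ha2⟩
      exact ⟨1, ha2, .single ha (c.notMem_of_mapsAffineRoot_simple hw hmax hds hda hap)⟩
    -- As w fixes δ, removing δ from `d` lowers the level of `a` by one and keeps its finite part.
    rcases c.exists_decomposition hd0 hds with h | ⟨e, f, he, hf, hef⟩
    · have hh : c.affineHeight (d.1, d.2 - 1) < c.affineHeight d := by
        have := c.height_pos
        simp only [affineHeight]
        linarith
      obtain ⟨k, hk, hk'⟩ := ih _ (by omega) (a := (a.1, a.2 - 1)) ha (d := (d.1, d.2 - 1))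
        (fun v => by
          have := hda v
          simp only [affineRootFun] at this ⊢
          push_cast
          linarith) h rfl
      exact ⟨k, by simp only at hk; omega, hk'⟩
    · obtain ⟨e', he', -⟩ := exists_mapsAffineRoot w e
      obtain ⟨f', hf', -⟩ := exists_mapsAffineRoot w f
      have hef' : ∀ v, P.affineRootFun a v = P.affineRootFun e' v + P.affineRootFun f' v := by
        intro v
        have h1 := hda (((w⁻¹ : P.affineWeylGroup) : N ≃ᵃ[ℝ] N) v)
        rw [hef, ← he', ← hf', coe_apply_coe_inv_apply] at h1
        exact h1
      obtain ⟨h2, hroot⟩ := eq_add_of_affineRootFun_eq_add hef'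
      have hheight := b.height_add hroot
      have hsum : c.affineHeight d = c.affineHeight e + c.affineHeight f := by
        obtain ⟨h3, h4⟩ := eq_add_of_affineRootFun_eq_add hef
        simp only [affineHeight, h3, b.height_add h4]
        ring
      have heh := (c.affineHeight_pos_iff e).mpr he
      have hfh := (c.affineHeight_pos_iff f).mpr hf
      have hle : ∀ i, b.IsPos i → i ∉ I → P.root' i ((w : N ≃ᵃ[ℝ] N) c.point) ≤ 1 :=
        fun i hi hiI => not_lt.mp fun h => hiI ((c.mem_iff_of_mem_signType hw hi).mpr h)
      have aux : ∀ {e f e' f' : ι × ℤ}, 0 < P.affineRootFun e c.point →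
          0 < P.affineRootFun f c.point → c.affineHeight f < c.affineHeight d →
          P.MapsAffineRoot w e e' → P.MapsAffineRoot w f f' → a.2 = e'.2 + f'.2 →
          P.root a.1 = P.root e'.1 + P.root f'.1 → ¬ b.IsPos e'.1 →
          ∃ k : ℕ, (k : ℤ) ≤ a.2 ∧ IsSumOutside b I k (P.root a.1) := by
        intro e f e' f' he hf hlt he' hf' h2 hroot hep
        let := P.indexNeg
        have hnep : b.IsPos (-e'.1) := by rwa [Base.IsPos.neg_iff_not]
        have hroot' : P.root f'.1 = P.root a.1 + P.root (-e'.1) := by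
          have : P.root (-e'.1) = -P.root e'.1 := by simp
          rw [this, hroot]
          abel
        obtain ⟨k, hk, hk'⟩ := ih _ (by omega) (a := f') (ha.add hnep hroot') f hf' hf rfl
        -- With β the negative of the finite part of e', split α + β into p and q roots, p + q ≤ k +
        -- 1 ≤ f'.2 + 1. Each summand is at most 1 at `w p`, so ⟨β, w p⟩ ≤ q. Positivity of e' there
        -- gives e'.2 + q ≥ 1 by integrality, which absorbs the extra root: p ≤ e'.2 + f'.2 = a.2.
        rw [hroot'] at hk'
        obtain ⟨p, q, hpq, hp, hq⟩ := hk'.exists_split hI ha hnep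
        have h3 : P.root' (-e'.1) ((w : N ≃ᵃ[ℝ] N) c.point) ≤ q := hq.le hle
        have h4 : (0 : ℝ) < e'.2 + q := by
          have h5 := he' c.point
          have h6 : P.root' (-e'.1) ((w : N ≃ᵃ[ℝ] N) c.point) =
              -P.root' e'.1 ((w : N ≃ᵃ[ℝ] N) c.point) := root'_reflectionPerm_self _ _
          rw [← h5] at he
          simp only [affineRootFun] at he
          linarith
        have h5 : 0 < e'.2 + (q : ℤ) := by exact_mod_cast h4
        exact ⟨p, by omega, hp⟩
      by_cases hep : b.IsPos e'.1
      · by_cases hfp : b.IsPos f'.1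
        · obtain ⟨k, hk, hk'⟩ := ih _ (by omega) hep e he' he rfl
          obtain ⟨l, hl, hl'⟩ := ih _ (by omega) hfp f hf' hf rfl
          exact ⟨k + l, by push_cast; omega, by rw [hroot]; exact hk'.add hl'⟩
        · exact aux hf he (by omega) hf' he' (by omega) (by rw [hroot, add_comm]) hfp
      · exact aux he hf (by omega) he' hf' h2 hroot hep

end AlcoveCenter

end SignType

end RootPairing

theorem mainTheorem7 {ι M N : Type*} [Finite ι]
    [AddCommGroup M] [Module ℝ M] [AddCommGroup N] [Module ℝ N]
    (P : RootPairing ι ℝ M N) [P.IsRootSystem] [P.IsCrystallographic] [P.IsReduced]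
    [P.IsIrreducible] (b : P.Base) (I : Set ι) (hI : RootPairing.IsRootIdeal b I)
    (w : P.affineWeylGroup) (hw : w ∈ RootPairing.signType b I) :
    (RootPairing.IsStrictlyPositive b I ∧ RootPairing.IsLongestInSignType b I w) ↔
      ∀ s ∈ RootPairing.simpleAffineReflections b,
        BruhatLT (RootPairing.simpleAffineReflections b) w (w * s) →
          w * s ∉ RootPairing.signType b I := by
  have := Fintype.ofFinite ι
  constructor
  · rintro ⟨-, -, hlongest⟩ s - hlt hmem
    have hlen : ∀ {u v : P.affineWeylGroup},
        BruhatLT (RootPairing.simpleAffineReflections b) u v →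
        wordLength (RootPairing.simpleAffineReflections b) u <
          wordLength (RootPairing.simpleAffineReflections b) v := fun h => by
      induction h with
      | single h => exact h.choose_spec.2.2
      | tail _ h ih => exact ih.trans h.choose_spec.2.2
    have h1 := hlen hlt
    have h2 := hlongest _ hmem (fun h => by rw [h] at h1; exact lt_irrefl _ h1)
    exact lt_asymm h1 h2
  · intro hmax
    obtain ⟨c⟩ := RootPairing.nonempty_alcoveCenter b
    refine ⟨fun i hi hiI => ?_, hw, fun x hx hxw => ?_⟩
    -- Any large level m will do: the bound k ≤ m is discarded, since height 1 already forces a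
    -- single summand.
    · obtain ⟨m, hm⟩ := exists_int_gt (P.root' i ((w : N ≃ᵃ[ℝ] N) c.point))
      obtain ⟨k, -, hk⟩ := c.exists_isSumOutside hI hw hmax (a := (i, m))
        (b.isPos_of_mem_support hi) (by simp only [RootPairing.affineRootFun]; linarith)
      have h1 := hk.height_le
      rw [b.height_one_of_mem_support hi] at h1
      obtain ⟨s, hs, hsI, hsum⟩ := hk
      have hne : s ≠ 0 := by rintro rfl; exact P.ne_zero i (by simpa using hsum)
      have hpos := Multiset.card_pos.mpr hne
      obtain ⟨j, rfl⟩ := Multiset.card_eq_one.mp (show Multiset.card s = 1 by omega)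
      have hij : i = j := P.root.injective (by simpa using hsum)
      exact (hsI j (by simp)).2 (hij ▸ hiI)
    · rw [c.wordLength_eq_ncard_inversionSet, c.wordLength_eq_ncard_inversionSet]
      have hsub : RootPairing.inversionSet b x ⊆ RootPairing.inversionSet b w := by
        intro a ha
        have haI : a.1 ∈ I := by
          rw [← show RootPairing.affineSupp b x = I from hx]
          exact ⟨a.2, ha⟩
        rw [c.mem_inversionSet_iff] at ha ⊢
        refine ⟨ha.1, lt_of_le_of_ne (not_lt.mp fun hpos => ?_)
          (c.affineRootFun_comp_ne_zero w a)⟩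
        obtain ⟨k, hk, hk'⟩ := c.exists_isSumOutside hI hw hmax (hI.isPos _ haI) hpos
        -- The decomposition was found using w, but the bound by 1 on roots outside I holds for
        -- every element of ST(I), so it transfers to x.
        have h1 : P.root' a.1 ((x : N ≃ᵃ[ℝ] N) c.point) ≤ k := hk'.le fun i hi hiI =>
          not_lt.mp fun h => hiI ((c.mem_iff_of_mem_signType hx hi).mpr h)
        have h2 : (k : ℝ) ≤ a.2 := by exact_mod_cast hk
        have h3 := ha.2
        simp only [RootPairing.affineRootFun] at h3
        linarith
      exact Set.ncard_lt_ncard (hsub.ssubset_of_ne fun h => hxw (c.inversionSet_injective h))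
        (c.finite_inversionSet w)
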